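/- **Definitions.** Let $p>2$ be a prime and $n\ge 0$. A *growth function* is an increasing function $\rho:\mathbb{R}_{\ge0}\to\mathbb{R}_{\ge0}$; it is *polynomial* if it is given by a real polynomial, and $\rho\ge\rho_0$ is meant pointwise. For $A\subseteq\mathbb{F}_p^n$, $\mathrm{VC}_2(A)$ is the largest $m$ for which there are $a_i,b_j,c_S\in\mathbb{F}_p^n$ ($i,j\in[m]$, $S\subseteq[m]^2$) with $a_i+b_j+c_S\in A\iff(i,j)\in S$. A *quadratic factor* $\mathcal B$ on $\mathbb{F}_p^n$ of complexity $(\ell,q)$ consists of linearly independent vectors $r_1,\dots,r_\ell\in\mathbb{F}_p^n$ and symmetric $n\times n$ matrices $M_1,\dots,M_q$ over $\mathbb{F}_p$. Its *rank* is the minimum of $\mathrm{rk}(\lambda_1M_1+\dots+\lambda_qM_q)$ over $(\lambda_1,\dots,\lambda_q)\in\mathbb{F}_p^q\setminus\{0\}$ (and $+\infty$ if $q=0$). For $a\in\mathbb{F}_p^{\ell+q}$ and $b\in\mathbb{F}_p^q$ put $$B(a)=\{x: x^Tr_i=a_i\ (i\le\ell),\ x^TM_jx=a_{\ell+j}\ (j\le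 q)\},\qquad \beta(b)=\{(x,y): x^TM_jy=b_j\ (j\le q)\},$$ and $\mu_{\beta}(x,y)=1_\beta(x,y)\,p^{2n}/|\beta|$. For $d=(a_1,a_2,a_3,b_{12},b_{13},b_{23})\in(\mathbb{F}_p^{\ell+q})^3\times(\mathbb{F}_p^q)^3$ put $\Sigma(d)=a_1+a_2+a_3+2(0b_{12})+2(0b_{13})+2(0b_{23})$, where $0b\in\mathbb{F}_p^{\ell+q}$ is $b$ preceded by $\ell$ zeros. For $f:\mathbb{F}_p^n\to\mathbb{C}$ the *local $U^3$ semi-norm* $\|f\|_{U^3(d)}\ge 0$ is defined by $$\|f\|_{U^3(d)}^8=\mathop{\mathbb{E}}_{x_0,x_1\in B(a_1)}\ \mathop{\mathbb{E}}_{y_0,y_1\in B(a_2)}\ \mathop{\mathbb{E}}_{z_0,z_1\in B(a_3)}\ \prod_{i,j\in\{0,1\}}\mu_{\beta(b_{12})}(x_i,y_j)\,\mu_{\beta(b_{13})}(x_i,z_j)\,\mu_{\beta(b_{23})}(y_i,z_j)\prod_{\omega\in\{0,1\}^3}\mathcal{C}^{|\omega|}f(x_{\omega(1)}+y_{\omega(2)}+z_{\omega(3)}),$$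 where $\mathcal C$ denotes complex conjugation and $|\omega|$ is the number of $1$s in $\omega$. **Proposition.** For all $\varepsilon>0$ and all integers $m\ge1$ there exist $\eta>0$ and a polynomial growth function $\rho_0$, depending only on $\varepsilon$ and $m$, such that for all primes $p>2$, all growth functions $\rho\ge\rho_0$, all integers $\ell,q\ge0$ and all $n>\ell+q$ the following holds. Let $A\subseteq\mathbb{F}_p^n$ satisfy $\mathrm{VC}_2(A)<m$, let $\mathcal B$ be a quadratic factor on $\mathbb{F}_p^n$ of complexity $(\ell,q)$ and rank at least $\rho(\ell+q)$, and let $d\in(\mathbb{F}_p^{\ell+q})^3\times(\mathbb{F}_p^q)^3$. Let $\alpha=|A\cap B(\Sigma(d))|/|B(\Sigma(d))|$ be the density of $A$ on the atom $B(\Sigma(d))$. If $\|1_A-\alpha\|_{U^3(d)}<\eta$, then $\alpha\in[0,\varepsilon)\cup(1-\varepsilon,1]$. -/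

import Mathlib

open scoped BigOperators NNReal ENNReal

namespace QuadFactor

/-- `A` has the `m`-independence property `IP₂` in the abelian group `G`: there are elements
`a i`, `b j` (for `i, j ∈ [m]`) and `c S` (for `S ⊆ [m] × [m]`) such that
`a i + b j + c S ∈ A` if and only if `(i, j) ∈ S`. -/
def HasIP2 {G : Type*} [AddCommGroup G] (m : ℕ) (A : Set G) : Prop :=
  ∃ (a : Fin m → G) (b : Fin m → G) (c : Finset (Fin m × Fin m) → G),
    ∀ (i j : Fin m) (S : Finset (Fin m × Fin m)), a i + b j + c S ∈ A ↔ (i, j) ∈ S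

/-- The `VC₂`-dimension of `A`: the largest `m` such that `A` has `m`-`IP₂`
(`⊤` if there is no largest one, which cannot happen in a finite group). -/
noncomputable def vc2Dim {G : Type*} [AddCommGroup G] (A : Set G) : ℕ∞ :=
  ⨆ (m : ℕ) (_ : HasIP2 m A), (m : ℕ∞)

/-- A growth function is an increasing function from the non-negative reals to themselves. -/
def IsGrowthFunction (ρ : ℝ≥0 → ℝ≥0) : Prop := StrictMono ρ

/-- `ρ` is given by a real polynomial. -/
def IsPolynomialFunction (ρ : ℝ≥0 → ℝ≥0) : Prop :=
  ∃ P : Polynomial ℝ, ∀ x : ℝ≥0, (ρ x : ℝ) = P.eval (x : ℝ)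

/-- A quadratic factor of complexity `(ℓ, q)` on `𝔽_p^n`: linearly independent vectors
`r₁, …, r_ℓ` and symmetric matrices `M₁, …, M_q`. -/
structure QuadraticFactor (p n ℓ q : ℕ) where
  r : Fin ℓ → (Fin n → ZMod p)
  linearIndependent : LinearIndependent (ZMod p) r
  M : Fin q → Matrix (Fin n) (Fin n) (ZMod p)
  isSymm : ∀ j, (M j).IsSymm

/-- Labels of atoms: elements of `𝔽_p^{ℓ+q}`, written as pairs in `𝔽_p^ℓ × 𝔽_p^q`. -/
abbrev AtomLabel (p ℓ q : ℕ) : Type := (Fin ℓ → ZMod p) × (Fin q → ZMod p)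

/-- Tuples `d = (a₁, a₂, a₃, b₁₂, b₁₃, b₂₃)` with `aᵢ ∈ 𝔽_p^{ℓ+q}` and `bᵢⱼ ∈ 𝔽_p^q`. -/
structure LabelTuple (p ℓ q : ℕ) where
  a₁ : AtomLabel p ℓ q
  a₂ : AtomLabel p ℓ q
  a₃ : AtomLabel p ℓ q
  b₁₂ : Fin q → ZMod p
  b₁₃ : Fin q → ZMod p
  b₂₃ : Fin q → ZMod p

/-- `Σ(d) = a₁ + a₂ + a₃ + 2 (0 b₁₂) + 2 (0 b₁₃) + 2 (0 b₂₃)`, where `0 b` is `b` preceded by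
`ℓ` zeros. -/
def LabelTuple.sigma {p ℓ q : ℕ} (d : LabelTuple p ℓ q) : AtomLabel p ℓ q :=
  d.a₁ + d.a₂ + d.a₃
    + 2 • ((0, d.b₁₂) : AtomLabel p ℓ q)
    + 2 • ((0, d.b₁₃) : AtomLabel p ℓ q)
    + 2 • ((0, d.b₂₃) : AtomLabel p ℓ q)

namespace QuadraticFactor

/-- The rank of a factor: the minimum of `rk (λ₁ M₁ + ⋯ + λ_q M_q)` over all `λ ≠ 0`.
It is `⊤` when `q = 0`, the minimum over the empty set. -/
noncomputable def rank {p n ℓ q : ℕ} (B : QuadraticFactor p n ℓ q) : ℕ∞ :=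
  ⨅ (c : Fin q → ZMod p) (_ : c ≠ 0), ((∑ j, c j • B.M j).rank : ℕ∞)

/-- The atom `B(a)`: all `x` with `xᵀ r_i = a_i` for `i ∈ [ℓ]` and `xᵀ M_j x = a_{ℓ+j}` for
`j ∈ [q]`. -/
def atom {p n ℓ q : ℕ} [NeZero p] (B : QuadraticFactor p n ℓ q) (a : AtomLabel p ℓ q) :
    Finset (Fin n → ZMod p) :=
  {x | (∀ i, x ⬝ᵥ B.r i = a.1 i) ∧ ∀ j, x ⬝ᵥ (B.M j).mulVec x = a.2 j}

/-- The bilinear level set `β(b)`: all `(x, y)` with `xᵀ M_j y = b_j` for `j ∈ [q]`. -/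
def bilinearLevel {p n ℓ q : ℕ} [NeZero p] (B : QuadraticFactor p n ℓ q) (b : Fin q → ZMod p) :
    Finset ((Fin n → ZMod p) × (Fin n → ZMod p)) :=
  {w | ∀ j, w.1 ⬝ᵥ (B.M j).mulVec w.2 = b j}

/-- The density `|A ∩ B(a)| / |B(a)|` of `A` on the atom `B(a)`. -/
noncomputable def density {p n ℓ q : ℕ} [NeZero p] (B : QuadraticFactor p n ℓ q)
    (A : Finset (Fin n → ZMod p)) (a : AtomLabel p ℓ q) : ℝ :=
  ((A ∩ B.atom a).card : ℝ) / ((B.atom a).card : ℝ)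

end QuadraticFactor

/-- The characteristic measure `μ_β = 1_β · |V|² / |β|` of a set of pairs `β ⊆ V × V`. -/
noncomputable def charMeasure {V : Type*} [Fintype V] [DecidableEq V] (β : Finset (V × V))
    (x y : V) : ℝ :=
  if (x, y) ∈ β then (Fintype.card V : ℝ) ^ 2 / (β.card : ℝ) else 0

/-- The local `U³` inner product of functions `f ω`, for `ω ∈ {0,1}³`, with respect to the
factor `B` and the tuple `d`. The pairs `(x₀, x₁)`, `(y₀, y₁)`, `(z₀, z₁)` are functions on
`Fin 2`. -/
noncomputable def localU3Inner {p n ℓ q : ℕ} [NeZero p] (B : QuadraticFactor p n ℓ q)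
    (d : LabelTuple p ℓ q) (f : (Fin 3 → Fin 2) → (Fin n → ZMod p) → ℂ) : ℂ :=
  𝔼 x ∈ Fintype.piFinset (fun _ : Fin 2 => B.atom d.a₁),
  𝔼 y ∈ Fintype.piFinset (fun _ : Fin 2 => B.atom d.a₂),
  𝔼 z ∈ Fintype.piFinset (fun _ : Fin 2 => B.atom d.a₃),
    (∏ i, ∏ j, (charMeasure (B.bilinearLevel d.b₁₂) (x i) (y j) : ℂ)) *
    (∏ i, ∏ k, (charMeasure (B.bilinearLevel d.b₁₃) (x i) (z k) : ℂ)) *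
    (∏ j, ∏ k, (charMeasure (B.bilinearLevel d.b₂₃) (y j) (z k) : ℂ)) *
    ∏ ω : Fin 3 → Fin 2,
      (starRingEnd ℂ)^[∑ s, (ω s : ℕ)] (f ω (x (ω 0) + y (ω 1) + z (ω 2)))

/-- The local `U³` semi-norm, the eighth root of the inner product of eight copies of `f`
(which is a non-negative real number, so that its real part is taken without loss). -/
noncomputable def localU3Norm {p n ℓ q : ℕ} [NeZero p] (B : QuadraticFactor p n ℓ q)
    (d : LabelTuple p ℓ q) (f : (Fin n → ZMod p) → ℂ) : ℝ :=
  (localU3Inner B d (fun _ => f)).re ^ (1 / 8 : ℝ)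

end QuadFactor

/-! Suppose the density α lies in [ε, 1 - ε]. The atoms of `a₁`, `a₂`, `a₃` are the classes of a
tripartite graph whose edges are given by the three bilinear level sets. On triangles of this graph,
f(x, y, z) = 1_A(x + y + z) - α is a bounded function with small box norm. A counting lemma then
yields every bipartite pattern at once: take m vertices x_i, m vertices y_j and one vertex z_S for
each S ⊆ [m]², and attach to (i, j, S) the factor 1_A if (i, j) ∈ S and 1 - 1_A otherwise. Each
factor is α + f or (1 - α) - f, so the product averages to at least about ε^T over complete
configurations, where T is the number of triples. It is therefore non-zero somewhere, which gives
`HasIP2 m A` and contradicts VC₂ < m.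

The graph is sparse, its densities being powers of 1/p, so every estimate must be relative to the
expected count for the constants not to depend on p, ℓ, q or n. High rank supplies this: by Weyl
differencing and orthogonality of characters (`norm_sum_systemForm_le`, `card_solutions_approx`),
all configurations of bounded size occur with the expected frequency up to a factor 1 ± 2^(-s)
(`QuadraticFactor.triPseudorandom`). A rank linear in ℓ + q suffices.

Given pseudorandomness, three weighted Cauchy–Schwarz steps (`gowers_cauchy_schwarz`) and a
second-moment count of extensions (`TriPseudorandom.abs_sum_extConf_mul_sub_le`) give a generalized
von Neumann inequality. `TriPseudorandom.exists_pattern` uses it to replace the factors by constants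
one at a time. -/

namespace QuadFactor

/-! ### Exponential sums and equidistribution over 𝔽_p. -/

section ExponentialSums

variable {p : ℕ} [Fact p.Prime]

/-- Orthogonality of characters of the form `x ↦ e(L x / p)`. -/
lemma sum_stdAddChar_addMonoidHom {W : Type*} [AddCommGroup W] [Fintype W] (L : W →+ ZMod p)
    [Decidable (L = 0)] :
    ∑ x, ZMod.stdAddChar (L x) = if L = 0 then (Fintype.card W : ℂ) else 0 := by
  classical
  have h := AddChar.sum_eq_ite ((ZMod.stdAddChar (N := p)).compAddMonoidHom L)
  have hiff : (ZMod.stdAddChar (N := p)).compAddMonoidHom L = 0 ↔ L = 0 := by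
    constructor
    · intro h0
      ext x
      have hx : ZMod.stdAddChar (L x) = 1 := by
        have := DFunLike.congr_fun h0 x
        simpa using this
      exact ZMod.injective_stdAddChar (by simpa using hx)
    · rintro rfl
      ext x
      simp
  simpa [hiff] using h

/-- Weyl differencing for a phase of degree two. -/
lemma norm_sq_sum_stdAddChar_le {W : Type*} [AddCommGroup W] [Fintype W] (Φ c : W → ZMod p)
    (D : W → W →+ ZMod p) (hΦ : ∀ x h, Φ (x + h) = Φ x + c h + D h x) :
    ‖∑ x, ZMod.stdAddChar (Φ x)‖ ^ 2
      ≤ (Fintype.card W : ℝ) * (Nat.card {h : W // D h = 0} : ℝ) := by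
  classical
  have key : (∑ x, ZMod.stdAddChar (Φ x)) * (starRingEnd ℂ) (∑ x, ZMod.stdAddChar (Φ x))
      = ∑ h, ZMod.stdAddChar (c h) * ∑ x, ZMod.stdAddChar (D h x) := by
    calc _ = ∑ x, ∑ y, ZMod.stdAddChar (Φ y) * ZMod.stdAddChar (-Φ x) := by
          rw [map_sum, Finset.sum_mul_sum, Finset.sum_comm]
          simp only [AddChar.map_neg_eq_conj]
      _ = ∑ x, ∑ h, ZMod.stdAddChar (c h) * ZMod.stdAddChar (D h x) := by
          refine Finset.sum_congr rfl fun x _ => ?_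
          -- Substituting y = x + h cancels the degree-two part in x and leaves the additive
          -- character of `D h`.
          rw [← Fintype.sum_equiv (Equiv.addLeft x) _ _ fun _ => rfl]
          refine Finset.sum_congr rfl fun h _ => ?_
          rw [← AddChar.map_add_eq_mul, ← AddChar.map_add_eq_mul, Equiv.coe_addLeft, hΦ]
          congr 1
          ring
      _ = _ := by
          rw [Finset.sum_comm]
          simp only [Finset.mul_sum]
  have hn : ‖∑ x, ZMod.stdAddChar (Φ x)‖ ^ 2
      = ‖(∑ x, ZMod.stdAddChar (Φ x)) * (starRingEnd ℂ) (∑ x, ZMod.stdAddChar (Φ x))‖ := by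
    rw [norm_mul, RCLike.norm_conj, sq]
  rw [hn, key]
  calc _ ≤ ∑ h, ‖ZMod.stdAddChar (c h) * ∑ x, ZMod.stdAddChar (D h x)‖ := norm_sum_le _ _
    _ = ∑ h, if D h = 0 then (Fintype.card W : ℝ) else 0 := by
        refine Finset.sum_congr rfl fun h _ => ?_
        rw [norm_mul, AddChar.norm_apply, one_mul, sum_stdAddChar_addMonoidHom]
        split_ifs <;> simp
    _ = _ := by
        rw [← Finset.sum_filter, Finset.sum_const, nsmul_eq_mul, mul_comm, Nat.card_eq_fintype_card,
          Fintype.card_subtype]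

/-- The kernel of a linear map of rank at least `R` has density at most `p ^ (-R)`. -/
lemma card_ker_mul_le {W W' : Type*} [AddCommGroup W] [Fintype W] [Module (ZMod p) W]
    [AddCommGroup W'] [Module (ZMod p) W'] (T : W →ₗ[ZMod p] W') {R : ℕ}
    (hR : R ≤ Module.finrank (ZMod p) (LinearMap.range T)) :
    Nat.card (LinearMap.ker T) * p ^ R ≤ Fintype.card W := by
  classical
  have : Fintype (LinearMap.ker T) := Fintype.ofFinite _
  have h1 := T.finrank_range_add_finrank_ker
  rw [Nat.card_eq_fintype_card, Module.card_eq_pow_finrank (K := ZMod p) (V := W),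
    Module.card_eq_pow_finrank (K := ZMod p) (V := LinearMap.ker T), ZMod.card, ← pow_add]
  exact Nat.pow_le_pow_right (Fact.out (p := p.Prime)).pos (by omega)

/-- Equidistribution of a system of functions all of whose non-trivial combinations have
small exponential sums. -/
lemma card_solutions_approx {W C : Type*} [Fintype W] [Fintype C] [DecidableEq C]
    (P : W → C → ZMod p) (t : C → ZMod p) (κ : ℝ)
    (hκ0 : 0 ≤ κ) (hκ : ∀ c : C → ZMod p, c ≠ 0 →
      ‖∑ x, ZMod.stdAddChar (∑ i, c i * P x i)‖ ≤ κ * Fintype.card W) :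
    |(Nat.card {x // P x = t} : ℝ) * (p : ℝ) ^ Fintype.card C - Fintype.card W|
      ≤ (p : ℝ) ^ Fintype.card C * (κ * Fintype.card W) := by
  classical
  have hcard : Fintype.card (C → ZMod p) = p ^ Fintype.card C := by simp
  have hsum : ∑ c : C → ZMod p, ∑ x, ZMod.stdAddChar (∑ i, c i * (P x i - t i))
      = (Nat.card {x // P x = t} : ℂ) * (p : ℂ) ^ Fintype.card C := by
    rw [Finset.sum_comm]
    have : ∀ x, ∑ c : C → ZMod p, ZMod.stdAddChar (∑ i, c i * (P x i - t i))
        = if P x = t then (p : ℂ) ^ Fintype.card C else 0 := by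
      intro x
      let L : (C → ZMod p) →+ ZMod p :=
        { toFun := fun c => ∑ i, c i * (P x i - t i)
          map_zero' := by simp
          map_add' := by intro a b; simp [add_mul, Finset.sum_add_distrib] }
      have hL : L = 0 ↔ P x = t := by
        constructor
        · intro h
          funext i
          have := DFunLike.congr_fun h (Pi.single i 1)
          simpa [L, Pi.single_apply, sub_eq_zero] using this
        · intro h
          ext c
          simp [L, h]
      have := sum_stdAddChar_addMonoidHom L
      rw [hcard] at this
      simp only [hL, Nat.cast_pow] at this
      exact this
    simp only [this]
    rw [← Finset.sum_filter, Finset.sum_const, nsmul_eq_mul, Nat.card_eq_fintype_card,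
      Fintype.card_subtype]
  -- The trivial character gives the main term |W|. Each of the fewer than p^|C| others costs at
  -- most κ|W|.
  rw [← Finset.add_sum_erase _ _ (Finset.mem_univ (0 : C → ZMod p))] at hsum
  have h0 : ∑ x : W, ZMod.stdAddChar (∑ i, (0 : C → ZMod p) i * (P x i - t i))
      = (Fintype.card W : ℂ) := by simp
  rw [h0] at hsum
  have hdiff : (((Nat.card {x // P x = t} : ℝ) * (p : ℝ) ^ Fintype.card C
        - Fintype.card W : ℝ) : ℂ)
      = ∑ c ∈ Finset.univ.erase (0 : C → ZMod p),
          ∑ x, ZMod.stdAddChar (∑ i, c i * (P x i - t i)) := by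
    push_cast
    rw [← hsum]
    ring
  rw [← Real.norm_eq_abs, ← Complex.norm_real, hdiff]
  calc _ ≤ ∑ c ∈ Finset.univ.erase (0 : C → ZMod p),
          ‖∑ x, ZMod.stdAddChar (∑ i, c i * (P x i - t i))‖ := norm_sum_le _ _
    _ ≤ ∑ c ∈ Finset.univ.erase (0 : C → ZMod p), κ * Fintype.card W := by
        refine Finset.sum_le_sum fun c hc => ?_
        have : ∑ x, ZMod.stdAddChar (∑ i, c i * (P x i - t i))
            = ZMod.stdAddChar (-∑ i, c i * t i) * ∑ x, ZMod.stdAddChar (∑ i, c i * P x i) := by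
          rw [Finset.mul_sum]
          refine Finset.sum_congr rfl fun x _ => ?_
          rw [← AddChar.map_add_eq_mul]
          congr 1
          simp only [mul_sub, Finset.sum_sub_distrib]
          ring
        rw [this, norm_mul, AddChar.norm_apply, one_mul]
        exact hκ c (Finset.ne_of_mem_erase hc)
    _ ≤ _ := by
        rw [Finset.sum_const, nsmul_eq_mul]
        have hle : (Finset.univ.erase (0 : C → ZMod p)).card ≤ p ^ Fintype.card C := by
          rw [← hcard]
          exact (Finset.card_le_card (Finset.erase_subset _ _)).trans_eq Finset.card_univ
        gcongr
        exact_mod_cast hle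

end ExponentialSums

/-! ### Systems of quadratic, bilinear and linear forms indexed by a graph. -/

section Systems

variable {p : ℕ} [Fact p.Prime] {n ℓ q : ℕ} {V E L : Type*} [Fintype V] [DecidableEq V]
  [Fintype E] [Fintype L]

/-- The system of forms attached to a graph with vertex set `V` and edge set `E` (loops allowed):
each edge carries the bilinear forms `M_j`, each element of `L` carries the linear forms `r_i`. -/
def systemForm (B : QuadraticFactor p n ℓ q) (src tgt : E → V) (lin : L → V)
    (x : V → Fin n → ZMod p) : (E × Fin q) ⊕ (L × Fin ℓ) → ZMod p :=
  Sum.elim (fun e => x (src e.1) ⬝ᵥ (B.M e.2).mulVec (x (tgt e.1)))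
    (fun l => x (lin l.1) ⬝ᵥ B.r l.2)

lemma QuadraticFactor.dotProduct_mulVec_comm (B : QuadraticFactor p n ℓ q) (j : Fin q)
    (x y : Fin n → ZMod p) : x ⬝ᵥ (B.M j).mulVec y = y ⬝ᵥ (B.M j).mulVec x := by
  rw [Matrix.dotProduct_mulVec, ← Matrix.mulVec_transpose, (B.isSymm j).eq, dotProduct_comm]

/-- The derivative of a combination of the quadratic forms in a system. -/
def systemDeriv (B : QuadraticFactor p n ℓ q) (src tgt : E → V) (c : E → Fin q → ZMod p)
    (h : V → Fin n → ZMod p) : (V → Fin n → ZMod p) →+ ZMod p :=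
  AddMonoidHom.mk' (fun x => ∑ e, ∑ j, c e j * (x (src e) ⬝ᵥ (B.M j).mulVec (h (tgt e))
      + h (src e) ⬝ᵥ (B.M j).mulVec (x (tgt e)))) (by
    intro a b
    simp only [Pi.add_apply, add_dotProduct, Matrix.mulVec_add, dotProduct_add,
      ← Finset.sum_add_distrib]
    refine Finset.sum_congr rfl fun e _ => Finset.sum_congr rfl fun j _ => ?_
    ring)

/-- One edge `e₀` with non-zero coefficients already forces rank. Testing the derivative at `tgt e₀`
and varying `h` only at `src e₀` isolates a non-zero combination of the M_j, because `hE` excludes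
parallel and reversed edges. -/
lemma card_systemDeriv_eq_zero_le (B : QuadraticFactor p n ℓ q) (hp : 2 < p) (src tgt : E → V)
    (hE : ∀ e e', (src e = src e' ∧ tgt e = tgt e') ∨ (src e = tgt e' ∧ tgt e = src e') → e = e')
    {R : ℕ} (hR : ∀ c : Fin q → ZMod p, c ≠ 0 → R ≤ (∑ j, c j • B.M j).rank)
    (c : E → Fin q → ZMod p) (hc : c ≠ 0) :
    Nat.card {h : V → Fin n → ZMod p // systemDeriv B src tgt c h = 0} * p ^ R
      ≤ Fintype.card (V → Fin n → ZMod p) := by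
  obtain ⟨e₀, he₀⟩ := Function.ne_iff.1 hc
  -- `T h` is the vector that represents the derivative on inputs supported at `tgt e₀`. It vanishes
  -- whenever the derivative does.
  let T : (V → Fin n → ZMod p) →ₗ[ZMod p] (Fin n → ZMod p) := ∑ e, ∑ j, c e j •
    ((if src e = tgt e₀ then (B.M j).mulVecLin ∘ₗ LinearMap.proj (tgt e) else 0)
      + (if tgt e = tgt e₀ then (B.M j).mulVecLin ∘ₗ LinearMap.proj (src e) else 0))
  have hT : ∀ h, T h = ∑ e, ∑ j, c e j •
      ((if src e = tgt e₀ then (B.M j).mulVec (h (tgt e)) else 0)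
      + (if tgt e = tgt e₀ then (B.M j).mulVec (h (src e)) else 0)) := by
    intro h
    simp only [T, LinearMap.sum_apply, LinearMap.smul_apply, LinearMap.add_apply]
    refine Finset.sum_congr rfl fun e _ => Finset.sum_congr rfl fun j _ => ?_
    split_ifs <;> simp
  have hker : ∀ h, systemDeriv B src tgt c h = 0 → h ∈ LinearMap.ker T := by
    intro h hh
    rw [LinearMap.mem_ker]
    refine dotProduct_eq_zero _ fun t => ?_
    have h1 := DFunLike.congr_fun hh (Pi.single (tgt e₀) t)
    simp only [systemDeriv, AddMonoidHom.mk'_apply, AddMonoidHom.zero_apply] at h1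
    rw [← h1, hT, dotProduct_comm, dotProduct_sum]
    refine Finset.sum_congr rfl fun e _ => ?_
    rw [dotProduct_sum]
    refine Finset.sum_congr rfl fun j _ => ?_
    rw [dotProduct_smul, smul_eq_mul, dotProduct_add, B.dotProduct_mulVec_comm j (h (src e))]
    simp only [Pi.single_apply]
    split_ifs <;> simp
  -- On a loop both halves of the derivative contribute the same term, hence the factor 2, which is
  -- invertible because p is odd.
  let k : ZMod p := if src e₀ = tgt e₀ then 2 else 1
  have hk : k ≠ 0 := by
    have h2 : (2 : ZMod p) ≠ 0 := by
      intro h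
      have : ((2 : ℕ) : ZMod p) = 0 := by exact_mod_cast h
      rw [ZMod.natCast_eq_zero_iff] at this
      exact absurd (Nat.le_of_dvd two_pos this) (by omega)
    simp only [k]
    split_ifs
    · exact h2
    · exact one_ne_zero
  have hTs : T ∘ₗ LinearMap.single (ZMod p) (fun _ : V => Fin n → ZMod p) (src e₀)
      = (∑ j, (k • c e₀) j • B.M j).mulVecLin := by
    refine LinearMap.ext fun g => ?_
    rw [LinearMap.comp_apply, hT, Finset.sum_eq_single e₀]
    · simp only [LinearMap.coe_single, Pi.single_apply, Matrix.mulVecLin_apply,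
        Matrix.sum_mulVec, Pi.smul_apply, k]
      refine Finset.sum_congr rfl fun j _ => ?_
      by_cases hl : src e₀ = tgt e₀
      · simp [hl, two_mul, add_smul, Matrix.add_mulVec, Matrix.smul_mulVec]
      · simp [hl, Matrix.smul_mulVec]
    · intro e _ hne
      refine Finset.sum_eq_zero fun j _ => ?_
      have h1 : ¬ (tgt e = src e₀ ∧ src e = tgt e₀) := fun h => hne (hE _ _ (Or.inr ⟨h.2, h.1⟩))
      have h2 : ¬ (tgt e = tgt e₀ ∧ src e = src e₀) := fun h => hne (hE _ _ (Or.inl ⟨h.2, h.1⟩))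
      simp only [LinearMap.coe_single, Pi.single_apply]
      have h3 : (if src e = tgt e₀ then (B.M j).mulVec (if tgt e = src e₀ then g else 0) else 0)
          = 0 := by
        split_ifs with h3 h4
        · exact absurd ⟨h4, h3⟩ h1
        · exact Matrix.mulVec_zero _
        · rfl
      have h5 : (if tgt e = tgt e₀ then (B.M j).mulVec (if src e = src e₀ then g else 0) else 0)
          = 0 := by
        split_ifs with h3 h4
        · exact absurd ⟨h3, h4⟩ h2
        · exact Matrix.mulVec_zero _
        · rfl
      rw [h3, h5, add_zero, smul_zero]
    · simp
  have hrank : R ≤ Module.finrank (ZMod p) (LinearMap.range T) := by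
    refine (hR (k • c e₀) (smul_ne_zero hk he₀)).trans ?_
    rw [Matrix.rank, ← hTs]
    exact Submodule.finrank_mono (LinearMap.range_comp_le_range _ _)
  refine le_trans (Nat.mul_le_mul_right _ ?_) (card_ker_mul_le T hrank)
  exact Nat.card_le_card_of_injective (fun h => (⟨h.1, hker h.1 h.2⟩ : LinearMap.ker T))
    (fun a b hab => Subtype.ext (congrArg (fun z : LinearMap.ker T => (z : V → Fin n → ZMod p)) hab))

/-- Exponential sums along non-trivial combinations of a system are small when the factor has
high rank. -/
lemma norm_sum_systemForm_le (B : QuadraticFactor p n ℓ q) (hp : 2 < p) (src tgt : E → V)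
    (hE : ∀ e e', (src e = src e' ∧ tgt e = tgt e') ∨ (src e = tgt e' ∧ tgt e = src e') → e = e')
    (lin : L → V) (hL : Function.Injective lin)
    {R : ℕ} (hR : ∀ c : Fin q → ZMod p, c ≠ 0 → 2 * R ≤ (∑ j, c j • B.M j).rank)
    (c : (E × Fin q) ⊕ (L × Fin ℓ) → ZMod p) (hc : c ≠ 0) :
    ‖∑ x : V → Fin n → ZMod p, ZMod.stdAddChar (∑ i, c i * systemForm B src tgt lin x i)‖
      ≤ ((p : ℝ) ^ R)⁻¹ * Fintype.card (V → Fin n → ZMod p) := by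
  have hp0 : (0 : ℝ) < p := by exact_mod_cast (by omega : 0 < p)
  let c₁ : E → Fin q → ZMod p := fun e j => c (Sum.inl (e, j))
  -- Without quadratic coefficients the phase is linear. It is non-trivial because the r_i are
  -- independent and `lin` puts at most one family of linear forms on each vertex, so the sum is
  -- exactly 0.
  by_cases hc₁ : c₁ = 0
  · have hz : ∀ e j, c (Sum.inl (e, j)) = 0 := fun e j => congrFun (congrFun hc₁ e) j
    let Λ : (V → Fin n → ZMod p) →+ ZMod p :=
      AddMonoidHom.mk' (fun x => ∑ i, c i * systemForm B src tgt lin x i) (by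
        intro a b
        simp only [systemForm, Fintype.sum_sum_type, Sum.elim_inl, Sum.elim_inr, hz, zero_mul,
          Finset.sum_const_zero, zero_add, Pi.add_apply, add_dotProduct, mul_add,
          Finset.sum_add_distrib])
    have hΛ : Λ ≠ 0 := by
      intro h0
      apply hc
      funext i
      rcases i with ⟨e, j⟩ | ⟨l, i⟩
      · exact hz e j
      · have hcomb : ∑ i, c (Sum.inr (l, i)) • B.r i = 0 := by
          refine dotProduct_eq_zero _ fun t => ?_
          have h1 := DFunLike.congr_fun h0 (Pi.single (lin l) t)
          simp only [Λ, AddMonoidHom.mk'_apply, AddMonoidHom.zero_apply, systemForm,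
            Fintype.sum_sum_type, Sum.elim_inl, Sum.elim_inr, hz, zero_mul,
            Finset.sum_const_zero, zero_add, Fintype.sum_prod_type] at h1
          rw [Finset.sum_eq_single l] at h1
          · rw [← h1, dotProduct_comm, dotProduct_sum]
            refine Finset.sum_congr rfl fun i _ => ?_
            rw [dotProduct_smul, smul_eq_mul, Pi.single_eq_same]
          · intro l' _ hne
            refine Finset.sum_eq_zero fun i _ => ?_
            rw [Pi.single_eq_of_ne (fun h => hne (hL h)), zero_dotProduct, mul_zero]
          · simp
        exact Fintype.linearIndependent_iff.1 B.linearIndependent _ hcomb i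
    have := sum_stdAddChar_addMonoidHom Λ
    rw [if_neg hΛ] at this
    have h2 : ∑ x : V → Fin n → ZMod p,
        ZMod.stdAddChar (∑ i, c i * systemForm B src tgt lin x i) = 0 := this
    rw [h2, norm_zero]
    positivity
  · have hΦ : ∀ x h : V → Fin n → ZMod p, ∑ i, c i * systemForm B src tgt lin (x + h) i
        = ∑ i, c i * systemForm B src tgt lin x i + ∑ i, c i * systemForm B src tgt lin h i
          + systemDeriv B src tgt c₁ h x := by
      intro x h
      simp only [systemForm, systemDeriv, AddMonoidHom.mk'_apply, Fintype.sum_sum_type,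
        Sum.elim_inl, Sum.elim_inr, Fintype.sum_prod_type, c₁, Pi.add_apply, add_dotProduct,
        Matrix.mulVec_add, dotProduct_add, mul_add, Finset.sum_add_distrib]
      ring
    have h1 := norm_sq_sum_stdAddChar_le
      (fun x => ∑ i, c i * systemForm B src tgt lin x i)
      (fun x => ∑ i, c i * systemForm B src tgt lin x i) (systemDeriv B src tgt c₁) hΦ
    have h2 := card_systemDeriv_eq_zero_le B hp src tgt hE hR c₁ hc₁
    have h2' : (Nat.card {h : V → Fin n → ZMod p // systemDeriv B src tgt c₁ h = 0} : ℝ)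
        * ((p : ℝ) ^ R) ^ 2 ≤ Fintype.card (V → Fin n → ZMod p) := by
      rw [← pow_mul, mul_comm R 2]
      exact_mod_cast h2
    -- Weyl differencing bounds the square of the sum, so rank 2R yields a saving of only p^(-R).
    refine abs_le_of_sq_le_sq' ?_ (by positivity) |>.2
    have hpR : (0 : ℝ) < (p : ℝ) ^ R := by positivity
    calc _ ≤ _ := h1
      _ ≤ (Fintype.card (V → Fin n → ZMod p) : ℝ)
          * (Fintype.card (V → Fin n → ZMod p) / ((p : ℝ) ^ R) ^ 2) := by
          gcongr
          rw [le_div_iff₀ (by positivity)]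
          exact h2'
      _ = _ := by
          field_simp

end Systems

/-! ### Tripartite configurations and their expected counts. -/

/-- Vertices `x i`, `y j`, `z k` are adjacent (for the relations `e₁₂`, `e₁₃`, `e₂₃`) whenever their
indices are related by `r₁₂`, `r₁₃`, `r₂₃`. -/
def TriConf {X Y Z I J K : Type*} (e₁₂ : X → Y → Prop) (e₁₃ : X → Z → Prop) (e₂₃ : Y → Z → Prop)
    (r₁₂ : I → J → Prop) (r₁₃ : I → K → Prop) (r₂₃ : J → K → Prop)
    (x : I → X) (y : J → Y) (z : K → Z) : Prop :=
  (∀ i j, r₁₂ i j → e₁₂ (x i) (y j)) ∧ (∀ i k, r₁₃ i k → e₁₃ (x i) (z k)) ∧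
    ∀ j k, r₂₃ j k → e₂₃ (y j) (z k)

open Classical in
/-- The expected number of configurations, when vertex classes have size `a` and edge densities
are `d`. -/
noncomputable def triMain (a d : ℝ) {I J K : Type*} [Fintype I] [Fintype J] [Fintype K]
    (r₁₂ : I → J → Prop) (r₁₃ : I → K → Prop) (r₂₃ : J → K → Prop) : ℝ :=
  a ^ (Fintype.card I + Fintype.card J + Fintype.card K) *
    ((∏ i, ∏ j, if r₁₂ i j then d else 1) * (∏ i, ∏ k, if r₁₃ i k then d else 1) *
      ∏ j, ∏ k, if r₂₃ j k then d else 1)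

/-- Configurations on at most `N` vertices in each class occur about as often as expected. -/
def TriPseudorandom {X Y Z : Type*} (e₁₂ : X → Y → Prop) (e₁₃ : X → Z → Prop)
    (e₂₃ : Y → Z → Prop) (a d δ : ℝ) (N : ℕ) : Prop :=
  ∀ (I J K : Type) [Fintype I] [Fintype J] [Fintype K], Fintype.card I ≤ N →
    Fintype.card J ≤ N → Fintype.card K ≤ N →
    ∀ (r₁₂ : I → J → Prop) (r₁₃ : I → K → Prop) (r₂₃ : J → K → Prop),
    |(Nat.card {w : (I → X) × (J → Y) × (K → Z) //
        TriConf e₁₂ e₁₃ e₂₃ r₁₂ r₁₃ r₂₃ w.1 w.2.1 w.2.2} : ℝ) - triMain a d r₁₂ r₁₃ r₂₃|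
      ≤ δ * triMain a d r₁₂ r₁₃ r₂₃

section Edges

variable {I J K : Type*} (r₁₂ : I → J → Prop) (r₁₃ : I → K → Prop) (r₂₃ : J → K → Prop)

/-- The edges of a tripartite graph, together with a loop at each vertex. -/
abbrev TriEdge : Type _ := (I ⊕ (J ⊕ K)) ⊕
  ({e : I × J // r₁₂ e.1 e.2} ⊕ ({e : I × K // r₁₃ e.1 e.2} ⊕ {e : J × K // r₂₃ e.1 e.2}))

/-- The first end point of an edge. -/
def triSrc : TriEdge r₁₂ r₁₃ r₂₃ → I ⊕ (J ⊕ K) :=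
  Sum.elim id (Sum.elim (fun e => Sum.inl e.1.1)
    (Sum.elim (fun e => Sum.inl e.1.1) (fun e => Sum.inr (Sum.inl e.1.1))))

/-- The second end point of an edge. -/
def triTgt : TriEdge r₁₂ r₁₃ r₂₃ → I ⊕ (J ⊕ K) :=
  Sum.elim id (Sum.elim (fun e => Sum.inr (Sum.inl e.1.2))
    (Sum.elim (fun e => Sum.inr (Sum.inr e.1.2)) (fun e => Sum.inr (Sum.inr e.1.2))))

lemma triEdge_eq (e e' : TriEdge r₁₂ r₁₃ r₂₃)
    (h : (triSrc _ _ _ e = triSrc _ _ _ e' ∧ triTgt _ _ _ e = triTgt _ _ _ e') ∨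
      (triSrc _ _ _ e = triTgt _ _ _ e' ∧ triTgt _ _ _ e = triSrc _ _ _ e')) : e = e' := by
  revert h
  rcases e with ((_ | _ | _) | ⟨⟨_, _⟩, _⟩ | ⟨⟨_, _⟩, _⟩ | ⟨⟨_, _⟩, _⟩) <;>
  rcases e' with ((_ | _ | _) | ⟨⟨_, _⟩, _⟩ | ⟨⟨_, _⟩, _⟩ | ⟨⟨_, _⟩, _⟩) <;>
  simp +contextual [triSrc, triTgt]

end Edges

/-! ### High rank implies pseudorandomness. -/

section

variable {p : ℕ} [Fact p.Prime] {n ℓ q : ℕ}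

/-- With D equations, passing to a relative error costs a factor p^D. The remaining p^(-s) is at
most 2^(-s), which removes the dependence on p. -/
lemma card_systemForm_eq_approx {V E L : Type*} [Fintype V] [DecidableEq V]
    [Fintype E] [Fintype L] (B : QuadraticFactor p n ℓ q) (hp : 2 < p) (src tgt : E → V)
    (hE : ∀ e e', (src e = src e' ∧ tgt e = tgt e') ∨ (src e = tgt e' ∧ tgt e = src e') → e = e')
    (lin : L → V) (hL : Function.Injective lin)
    {R s D : ℕ} (hR : ∀ c : Fin q → ZMod p, c ≠ 0 → 2 * R ≤ (∑ j, c j • B.M j).rank)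
    (hD : Fintype.card E * q + Fintype.card L * ℓ = D) (hRD : D + s ≤ R)
    (t : (E × Fin q) ⊕ (L × Fin ℓ) → ZMod p) :
    |(Nat.card {x // systemForm B src tgt lin x = t} : ℝ)
        - ((p : ℝ) ^ n) ^ Fintype.card V / (p : ℝ) ^ D|
      ≤ (1 / 2) ^ s * (((p : ℝ) ^ n) ^ Fintype.card V / (p : ℝ) ^ D) := by
  classical
  have hp1 : (2 : ℝ) ≤ p := by exact_mod_cast (by omega : 2 ≤ p)
  have hp0 : (0 : ℝ) < p := by linarith
  have h := card_solutions_approx (systemForm B src tgt lin) t ((p : ℝ) ^ R)⁻¹ (by positivity)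
    (norm_sum_systemForm_le B hp src tgt hE lin hL hR)
  have hC : Fintype.card ((E × Fin q) ⊕ (L × Fin ℓ)) = D := by simp [← hD]
  have hW : (Fintype.card (V → Fin n → ZMod p) : ℝ) = ((p : ℝ) ^ n) ^ Fintype.card V := by simp
  rw [hC, hW] at h
  have hpD : (0 : ℝ) < (p : ℝ) ^ D := by positivity
  have hs : (p : ℝ) ^ D * ((p : ℝ) ^ R)⁻¹ ≤ (1 / 2) ^ s := by
    rw [one_div, inv_pow, ← div_eq_mul_inv, div_le_iff₀ (by positivity), inv_mul_eq_div,
      le_div_iff₀ (by positivity)]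
    calc (p : ℝ) ^ D * 2 ^ s ≤ (p : ℝ) ^ D * (p : ℝ) ^ s := by gcongr
      _ = (p : ℝ) ^ (D + s) := (pow_add _ _ _).symm
      _ ≤ (p : ℝ) ^ R := pow_le_pow_right₀ (by linarith) hRD
  set M : ℝ := ((p : ℝ) ^ n) ^ Fintype.card V
  set N : ℝ := (Nat.card {x // systemForm B src tgt lin x = t} : ℝ)
  have hM : 0 ≤ M := by positivity
  have h2 : |N - M / (p : ℝ) ^ D| * (p : ℝ) ^ D = |N * (p : ℝ) ^ D - M| := by
    rw [← abs_of_pos hpD, ← abs_mul, abs_of_pos hpD, sub_mul, div_mul_cancel₀ _ hpD.ne']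
  rw [← mul_div_assoc, le_div_iff₀ hpD, h2]
  refine h.trans ?_
  rw [← mul_assoc]
  gcongr

/-- High rank makes the tripartite graph formed by three atoms and three bilinear level sets
pseudorandom. -/
lemma QuadraticFactor.triPseudorandom (B : QuadraticFactor p n ℓ q) (hp : 2 < p)
    (d : LabelTuple p ℓ q) {N s : ℕ}
    (hR : ∀ c : Fin q → ZMod p, c ≠ 0 →
      2 * ((ℓ + q) * (3 * N + 3 * N ^ 2) + s) ≤ (∑ j, c j • B.M j).rank) :
    TriPseudorandom (X := {x // x ∈ B.atom d.a₁}) (Y := {x // x ∈ B.atom d.a₂})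
      (Z := {x // x ∈ B.atom d.a₃})
      (fun x y => (x.1, y.1) ∈ B.bilinearLevel d.b₁₂)
      (fun x z => (x.1, z.1) ∈ B.bilinearLevel d.b₁₃)
      (fun y z => (y.1, z.1) ∈ B.bilinearLevel d.b₂₃)
      ((p : ℝ) ^ n / (p : ℝ) ^ (ℓ + q)) (1 / (p : ℝ) ^ q) ((1 / 2) ^ s) N := by
  classical
  intro I J K _ _ _ hI hJ hK r₁₂ r₁₃ r₂₃
  let E₁₂ := {e : I × J // r₁₂ e.1 e.2}
  let E₁₃ := {e : I × K // r₁₃ e.1 e.2}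
  let E₂₃ := {e : J × K // r₂₃ e.1 e.2}
  let V := I ⊕ (J ⊕ K)
  -- The loops carry the quadratic equations of the atoms, the genuine edges carry the level sets,
  -- and each vertex carries the linear equations of its atom.
  let E := TriEdge r₁₂ r₁₃ r₂₃
  let src : E → V := triSrc r₁₂ r₁₃ r₂₃
  let tgt : E → V := triTgt r₁₂ r₁₃ r₂₃
  let a : V → AtomLabel p ℓ q := Sum.elim (fun _ => d.a₁) (Sum.elim (fun _ => d.a₂) fun _ => d.a₃)
  let t : (E × Fin q) ⊕ (V × Fin ℓ) → ZMod p := Sum.elim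
    (fun e => Sum.elim (fun v => (a v).2) (Sum.elim (fun _ => d.b₁₂)
      (Sum.elim (fun _ => d.b₁₃) (fun _ => d.b₂₃))) e.1 e.2)
    (fun l => (a l.1).1 l.2)
  have hiff : ∀ x : V → Fin n → ZMod p, systemForm B src tgt id x = t ↔
      ((∀ i, x (Sum.inl i) ∈ B.atom d.a₁) ∧ (∀ j, x (Sum.inr (Sum.inl j)) ∈ B.atom d.a₂) ∧
        ∀ k, x (Sum.inr (Sum.inr k)) ∈ B.atom d.a₃) ∧
      (∀ i j, r₁₂ i j → (x (Sum.inl i), x (Sum.inr (Sum.inl j))) ∈ B.bilinearLevel d.b₁₂) ∧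
      (∀ i k, r₁₃ i k → (x (Sum.inl i), x (Sum.inr (Sum.inr k))) ∈ B.bilinearLevel d.b₁₃) ∧
      ∀ j k, r₂₃ j k →
        (x (Sum.inr (Sum.inl j)), x (Sum.inr (Sum.inr k))) ∈ B.bilinearLevel d.b₂₃ := by
    intro x
    simp only [funext_iff, Sum.forall, Prod.forall, systemForm, Sum.elim_inl, Sum.elim_inr, t,
      a, src, tgt, triSrc, triTgt, id, E, V, Subtype.forall, QuadraticFactor.atom,
      QuadraticFactor.bilinearLevel, Finset.mem_filter, Finset.mem_univ, true_and, forall_and]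
    tauto
  have hcard : Nat.card {x : V → Fin n → ZMod p // systemForm B src tgt id x = t}
      = Nat.card {w : (I → {x // x ∈ B.atom d.a₁}) × (J → {x // x ∈ B.atom d.a₂}) ×
          (K → {x // x ∈ B.atom d.a₃}) //
        TriConf (fun x y => (x.1, y.1) ∈ B.bilinearLevel d.b₁₂)
          (fun x z => (x.1, z.1) ∈ B.bilinearLevel d.b₁₃)
          (fun y z => (y.1, z.1) ∈ B.bilinearLevel d.b₂₃) r₁₂ r₁₃ r₂₃ w.1 w.2.1 w.2.2} := by
    refine Nat.card_congr
      { toFun := fun x => ⟨(fun i => ⟨x.1 (Sum.inl i), ((hiff x.1).1 x.2).1.1 i⟩,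
          fun j => ⟨x.1 (Sum.inr (Sum.inl j)), ((hiff x.1).1 x.2).1.2.1 j⟩,
          fun k => ⟨x.1 (Sum.inr (Sum.inr k)), ((hiff x.1).1 x.2).1.2.2 k⟩),
          ((hiff x.1).1 x.2).2⟩
        invFun := fun w => ⟨Sum.elim (fun i => (w.1.1 i).1)
            (Sum.elim (fun j => (w.1.2.1 j).1) fun k => (w.1.2.2 k).1), (hiff _).2
          ⟨⟨fun i => (w.1.1 i).2, fun j => (w.1.2.1 j).2, fun k => (w.1.2.2 k).2⟩, w.2⟩⟩
        left_inv := ?_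
        right_inv := ?_ }
    · rintro ⟨x, hx⟩
      refine Subtype.ext (funext ?_)
      rintro (_ | _ | _) <;> rfl
    · rintro ⟨⟨x, y, z⟩, hw⟩
      rfl
  have hE₁₂ : Fintype.card E₁₂ ≤ N ^ 2 := by
    refine (Fintype.card_subtype_le _).trans ?_
    rw [Fintype.card_prod, sq]
    exact Nat.mul_le_mul hI hJ
  have hE₁₃ : Fintype.card E₁₃ ≤ N ^ 2 := by
    refine (Fintype.card_subtype_le _).trans ?_
    rw [Fintype.card_prod, sq]
    exact Nat.mul_le_mul hI hK
  have hE₂₃ : Fintype.card E₂₃ ≤ N ^ 2 := by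
    refine (Fintype.card_subtype_le _).trans ?_
    rw [Fintype.card_prod, sq]
    exact Nat.mul_le_mul hJ hK
  have hV : Fintype.card V = Fintype.card I + Fintype.card J + Fintype.card K := by
    simp [V, add_assoc]
  have hEc : Fintype.card E = Fintype.card V + (Fintype.card E₁₂ + Fintype.card E₁₃
      + Fintype.card E₂₃) := by
    simp [E, TriEdge, V, add_assoc, E₁₂, E₁₃, E₂₃]
  have hmain := card_systemForm_eq_approx B hp src tgt (triEdge_eq r₁₂ r₁₃ r₂₃) (id : V → V) Function.injective_id
    hR (s := s) rfl (by
      gcongr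
      -- Each vertex has its own loop, so |V| ≤ |E|, while |E| ≤ 3N + 3N².
      calc Fintype.card E * q + Fintype.card V * ℓ
          ≤ Fintype.card E * q + Fintype.card E * ℓ := by
            gcongr
            omega
        _ = (ℓ + q) * Fintype.card E := by ring
        _ ≤ _ := by
            gcongr
            omega) t
  rw [hcard] at hmain
  have hprod : ∀ {I' J' : Type} [Fintype I'] [Fintype J'] (r : I' → J' → Prop) (δ : ℝ),
      ∏ i, ∏ j, (if r i j then δ else 1) = δ ^ Fintype.card {e : I' × J' // r e.1 e.2} := by
    intro I' J' _ _ r δ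
    rw [← Fintype.prod_prod_type', ← Finset.prod_filter, Finset.prod_const, Fintype.card_subtype]
  have hM : triMain ((p : ℝ) ^ n / (p : ℝ) ^ (ℓ + q)) (1 / (p : ℝ) ^ q) r₁₂ r₁₃ r₂₃
      = ((p : ℝ) ^ n) ^ Fintype.card V
        / (p : ℝ) ^ (Fintype.card E * q + Fintype.card V * ℓ) := by
    rw [triMain, hprod, hprod, hprod, ← pow_add, ← pow_add, ← hV, hEc, div_pow, div_pow, one_pow,
      div_mul_div_comm, mul_one, ← pow_mul, ← pow_mul, ← pow_mul, ← pow_add]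
    congr 2
    ring
  rw [hM]
  exact hmain

end

/-! ### Weighted Cauchy–Schwarz and box norms. -/

/-- Cauchy–Schwarz with weight `U`. A bounded factor is discarded but its supporting weight is kept,
so nothing is lost in a sparse setting. -/
lemma sum_mul_sq_le_of_abs_le {ι : Type*} [Fintype ι] (u a U : ι → ℝ) (hu : ∀ i, |u i| ≤ U i) :
    (∑ i, u i * a i) ^ 2 ≤ (∑ i, U i) * ∑ i, U i * a i ^ 2 := by
  have hU : ∀ i, 0 ≤ U i := fun i => (abs_nonneg _).trans (hu i)
  refine Finset.sum_sq_le_sum_mul_sum_of_sq_le_mul _ (fun i _ => hU i)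
    (fun i _ => mul_nonneg (hU i) (sq_nonneg _)) fun i _ => ?_
  have : u i ^ 2 ≤ U i ^ 2 := sq_le_sq.2 ((hu i).trans (le_abs_self _))
  calc (u i * a i) ^ 2 = u i ^ 2 * a i ^ 2 := by ring
    _ ≤ U i ^ 2 * a i ^ 2 := by gcongr
    _ = _ := by ring

lemma sum_sq_eq_sum_fin_two {X : Type*} [Fintype X] (a : X → ℝ) :
    (∑ x, a x) ^ 2 = ∑ x : Fin 2 → X, a (x 0) * a (x 1) := by
  classical
  rw [Fintype.sum_pow]
  simp only [Fin.prod_univ_two]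

/-- The Gowers–Cauchy–Schwarz inequality for tripartite functions, relative to weights. -/
lemma gowers_cauchy_schwarz {Ω X Y Z : Type*} [Fintype Ω] [Fintype X] [Fintype Y] [Fintype Z]
    (f : X → Y → Z → ℝ) (g G : Ω → X → Y → ℝ) (h H : Ω → X → Z → ℝ) (k K : Ω → Y → Z → ℝ)
    (hg : ∀ w x y, |g w x y| ≤ G w x y) (hh : ∀ w x z, |h w x z| ≤ H w x z)
    (hk : ∀ w y z, |k w y z| ≤ K w y z) :
    (∑ w, ∑ x, ∑ y, ∑ z, f x y z * g w x y * h w x z * k w y z) ^ 8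
      ≤ (∑ w, ∑ y, ∑ z, K w y z) ^ 4
        * (∑ w, ∑ x : Fin 2 → X, ∑ z, H w (x 0) z * H w (x 1) z) ^ 2
        * (∑ w, ∑ x : Fin 2 → X, ∑ y : Fin 2 → Y,
            (G w (x 0) (y 0) * G w (x 1) (y 0)) * (G w (x 0) (y 1) * G w (x 1) (y 1)))
        * ∑ w, ∑ x : Fin 2 → X, ∑ y : Fin 2 → Y, ∑ z : Fin 2 → Z,
            (G w (x 0) (y 0) * G w (x 1) (y 0)) * (G w (x 0) (y 1) * G w (x 1) (y 1))
            * ((H w (x 0) (z 0) * H w (x 1) (z 0)) * (K w (y 0) (z 0) * K w (y 1) (z 0)))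
            * ((H w (x 0) (z 1) * H w (x 1) (z 1)) * (K w (y 0) (z 1) * K w (y 1) (z 1)))
            * ∏ i, ∏ j, ∏ l, f (x i) (y j) (z l) := by
  set S := ∑ w, ∑ x, ∑ y, ∑ z, f x y z * g w x y * h w x z * k w y z
  set A := ∑ w, ∑ y, ∑ z, K w y z
  set B := ∑ w, ∑ x : Fin 2 → X, ∑ z, H w (x 0) z * H w (x 1) z
  set C := ∑ w, ∑ x : Fin 2 → X, ∑ y : Fin 2 → Y,
    (G w (x 0) (y 0) * G w (x 1) (y 0)) * (G w (x 0) (y 1) * G w (x 1) (y 1))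
  have hG : ∀ w x y, 0 ≤ G w x y := fun w x y => (abs_nonneg _).trans (hg w x y)
  have hH : ∀ w x z, 0 ≤ H w x z := fun w x z => (abs_nonneg _).trans (hh w x z)
  have hK : ∀ w y z, 0 ≤ K w y z := fun w y z => (abs_nonneg _).trans (hk w y z)
  have hA : 0 ≤ A := Finset.sum_nonneg fun w _ => Finset.sum_nonneg fun y _ =>
    Finset.sum_nonneg fun z _ => hK w y z
  have hB : 0 ≤ B := Finset.sum_nonneg fun w _ => Finset.sum_nonneg fun y _ =>
    Finset.sum_nonneg fun z _ => mul_nonneg (hH _ _ _) (hH _ _ _)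
  -- Cauchy–Schwarz over (w, y, z) discards `k` and doubles x.
  have h₁ : S ^ 2 ≤ A * ∑ w, ∑ x : Fin 2 → X, ∑ z, (h w (x 0) z * h w (x 1) z)
      * ∑ y, K w y z * ((f (x 0) y z * g w (x 0) y) * (f (x 1) y z * g w (x 1) y)) := by
    have e₁ : S = ∑ i : Ω × Y × Z, k i.1 i.2.1 i.2.2
        * ∑ x, f x i.2.1 i.2.2 * g i.1 x i.2.1 * h i.1 x i.2.2 := by
      simp only [Fintype.sum_prod_type, Finset.mul_sum]
      refine Finset.sum_congr rfl fun w _ => ?_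
      rw [Finset.sum_comm]
      refine Finset.sum_congr rfl fun y _ => ?_
      rw [Finset.sum_comm]
      refine Finset.sum_congr rfl fun z _ => Finset.sum_congr rfl fun x _ => ?_
      ring
    rw [e₁]
    refine (sum_mul_sq_le_of_abs_le _ _ (fun i : Ω × Y × Z => K i.1 i.2.1 i.2.2)
      fun i => hk _ _ _).trans (le_of_eq ?_)
    simp only [Fintype.sum_prod_type, sum_sq_eq_sum_fin_two]
    refine congrArg₂ _ rfl ?_
    simp only [Finset.mul_sum]
    refine Finset.sum_congr rfl fun w _ => ?_
    rw [Finset.sum_comm, Finset.sum_congr rfl fun z _ => Finset.sum_comm, Finset.sum_comm]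
    refine Finset.sum_congr rfl fun x _ => ?_
    refine Finset.sum_congr rfl fun z _ => ?_
    refine Finset.sum_congr rfl fun y _ => ?_
    ring
  set Q₁ := ∑ w, ∑ x : Fin 2 → X, ∑ z, (h w (x 0) z * h w (x 1) z)
      * ∑ y, K w y z * ((f (x 0) y z * g w (x 0) y) * (f (x 1) y z * g w (x 1) y))
  -- Cauchy–Schwarz over (w, x₀, x₁, z) discards `h` and doubles y.
  have h₂ : Q₁ ^ 2 ≤ B * ∑ w, ∑ x : Fin 2 → X, ∑ y : Fin 2 → Y,
      ((g w (x 0) (y 0) * g w (x 1) (y 0)) * (g w (x 0) (y 1) * g w (x 1) (y 1)))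
      * ∑ z, (H w (x 0) z * H w (x 1) z) * (K w (y 0) z * K w (y 1) z)
        * ∏ i, ∏ j, f (x i) (y j) z := by
    have e₁ : Q₁ = ∑ i : Ω × (Fin 2 → X) × Z, (h i.1 (i.2.1 0) i.2.2 * h i.1 (i.2.1 1) i.2.2)
        * ∑ y, K i.1 y i.2.2 * ((f (i.2.1 0) y i.2.2 * g i.1 (i.2.1 0) y)
          * (f (i.2.1 1) y i.2.2 * g i.1 (i.2.1 1) y)) := by
      simp only [Fintype.sum_prod_type, Q₁]
    rw [e₁]
    refine (sum_mul_sq_le_of_abs_le _ _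
      (fun i : Ω × (Fin 2 → X) × Z => H i.1 (i.2.1 0) i.2.2 * H i.1 (i.2.1 1) i.2.2)
      fun i => ?_).trans (le_of_eq ?_)
    · rw [abs_mul]
      exact mul_le_mul (hh _ _ _) (hh _ _ _) (abs_nonneg _) (hH _ _ _)
    simp only [Fintype.sum_prod_type, sum_sq_eq_sum_fin_two]
    refine congrArg₂ _ rfl ?_
    simp only [Finset.mul_sum]
    refine Finset.sum_congr rfl fun w _ => Finset.sum_congr rfl fun x _ => ?_
    rw [Finset.sum_comm]
    refine Finset.sum_congr rfl fun y _ => Finset.sum_congr rfl fun z _ => ?_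
    simp only [Fin.prod_univ_two]
    ring
  set Q₂ := ∑ w, ∑ x : Fin 2 → X, ∑ y : Fin 2 → Y,
      ((g w (x 0) (y 0) * g w (x 1) (y 0)) * (g w (x 0) (y 1) * g w (x 1) (y 1)))
      * ∑ z, (H w (x 0) z * H w (x 1) z) * (K w (y 0) z * K w (y 1) z)
        * ∏ i, ∏ j, f (x i) (y j) z
  -- Cauchy–Schwarz over (w, x₀, x₁, y₀, y₁) discards `g` and doubles z.
  have h₃ : Q₂ ^ 2 ≤ C * ∑ w, ∑ x : Fin 2 → X, ∑ y : Fin 2 → Y, ∑ z : Fin 2 → Z,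
            (G w (x 0) (y 0) * G w (x 1) (y 0)) * (G w (x 0) (y 1) * G w (x 1) (y 1))
            * ((H w (x 0) (z 0) * H w (x 1) (z 0)) * (K w (y 0) (z 0) * K w (y 1) (z 0)))
            * ((H w (x 0) (z 1) * H w (x 1) (z 1)) * (K w (y 0) (z 1) * K w (y 1) (z 1)))
            * ∏ i, ∏ j, ∏ l, f (x i) (y j) (z l) := by
    have e₁ : Q₂ = ∑ i : Ω × (Fin 2 → X) × (Fin 2 → Y),
      ((g i.1 (i.2.1 0) (i.2.2 0) * g i.1 (i.2.1 1) (i.2.2 0))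
        * (g i.1 (i.2.1 0) (i.2.2 1) * g i.1 (i.2.1 1) (i.2.2 1)))
      * ∑ z, (H i.1 (i.2.1 0) z * H i.1 (i.2.1 1) z) * (K i.1 (i.2.2 0) z * K i.1 (i.2.2 1) z)
        * ∏ a, ∏ j, f (i.2.1 a) (i.2.2 j) z := by
      simp only [Fintype.sum_prod_type, Q₂]
    rw [e₁]
    refine (sum_mul_sq_le_of_abs_le _ _
      (fun i : Ω × (Fin 2 → X) × (Fin 2 → Y) =>
        (G i.1 (i.2.1 0) (i.2.2 0) * G i.1 (i.2.1 1) (i.2.2 0))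
        * (G i.1 (i.2.1 0) (i.2.2 1) * G i.1 (i.2.1 1) (i.2.2 1)))
      fun i => ?_).trans (le_of_eq ?_)
    · have h2 : ∀ w x x' y, |g w x y * g w x' y| ≤ G w x y * G w x' y := fun w x x' y => by
        rw [abs_mul]
        exact mul_le_mul (hg _ _ _) (hg _ _ _) (abs_nonneg _) (hG _ _ _)
      rw [abs_mul]
      exact mul_le_mul (h2 _ _ _ _) (h2 _ _ _ _) (abs_nonneg _)
        (mul_nonneg (hG _ _ _) (hG _ _ _))
    simp only [Fintype.sum_prod_type, sum_sq_eq_sum_fin_two]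
    refine congrArg₂ _ rfl ?_
    simp only [Finset.mul_sum]
    refine Finset.sum_congr rfl fun w _ => Finset.sum_congr rfl fun x _ =>
      Finset.sum_congr rfl fun y _ => Finset.sum_congr rfl fun z _ => ?_
    simp only [Fin.prod_univ_two]
    ring
  set Q₃ := ∑ w, ∑ x : Fin 2 → X, ∑ y : Fin 2 → Y, ∑ z : Fin 2 → Z,
            (G w (x 0) (y 0) * G w (x 1) (y 0)) * (G w (x 0) (y 1) * G w (x 1) (y 1))
            * ((H w (x 0) (z 0) * H w (x 1) (z 0)) * (K w (y 0) (z 0) * K w (y 1) (z 0)))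
            * ((H w (x 0) (z 1) * H w (x 1) (z 1)) * (K w (y 0) (z 1) * K w (y 1) (z 1)))
            * ∏ i, ∏ j, ∏ l, f (x i) (y j) (z l)
  calc S ^ 8 = ((S ^ 2) ^ 2) ^ 2 := by ring
    _ ≤ ((A * Q₁) ^ 2) ^ 2 := by gcongr
    _ = A ^ 4 * (Q₁ ^ 2) ^ 2 := by ring
    _ ≤ A ^ 4 * (B * Q₂) ^ 2 := by gcongr
    _ = A ^ 4 * B ^ 2 * Q₂ ^ 2 := by ring
    _ ≤ A ^ 4 * B ^ 2 * (C * Q₃) := by gcongr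
    _ = _ := by ring

/-! ### Counting the extensions of a configuration. -/

open Classical in
/-- The real-valued indicator of a proposition. -/
noncomputable def ind (P : Prop) : ℝ := if P then 1 else 0

lemma ind_nonneg (P : Prop) : 0 ≤ ind P := by
  unfold ind
  split_ifs <;> norm_num

lemma ind_mul (P Q : Prop) : ind P * ind Q = ind (P ∧ Q) := by
  unfold ind
  by_cases hP : P <;> by_cases hQ : Q <;> simp [hP, hQ]

lemma ind_congr {P Q : Prop} (h : P ↔ Q) : ind P = ind Q := by
  rw [propext h]

lemma sum_sumArrow {A B X : Type*} [Fintype A] [Fintype B] [DecidableEq A] [DecidableEq B]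
    [Fintype X] (F : (A ⊕ B → X) → ℝ) :
    ∑ x, F x = ∑ a : A → X, ∑ b : B → X, F (Sum.elim a b) := by
  rw [← Fintype.sum_prod_type']
  exact (Fintype.sum_equiv (Equiv.sumArrowEquivProdArrow A B X).symm _ _ fun _ => rfl).symm

lemma sum_unitArrow {X : Type*} [Fintype X] (F : (Unit → X) → ℝ) :
    ∑ x, F x = ∑ a, F fun _ => a :=
  Fintype.sum_equiv (Equiv.funUnique Unit X) _ _ fun _ => rfl

section

variable {X Y Z : Type*}
  {e₁₂ : X → Y → Prop} {e₁₃ : X → Z → Prop} {e₂₃ : Y → Z → Prop} {a d δ : ℝ} {N : ℕ}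

variable (e₁₂ e₁₃ e₂₃) in
/-- Adding the vertices `x`, `y`, `z` to `w` gives a complete tripartite configuration. -/
def ExtConf {A A' B B' C C' : Type} (w : (A' → X) × (B' → Y) × (C' → Z)) (x : A → X) (y : B → Y)
    (z : C → Z) : Prop :=
  TriConf e₁₂ e₁₃ e₂₃ (fun _ _ => True) (fun _ _ => True) (fun _ _ => True)
    (Sum.elim x w.1) (Sum.elim y w.2.1) (Sum.elim z w.2.2)

/-- Two vertices are related unless they belong to different copies in a doubled configuration. -/
def doubleRel {A B A' B' : Type} : A ⊕ (A' ⊕ A') → B ⊕ (B' ⊕ B') → Prop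
  | Sum.inr (Sum.inl _), Sum.inr (Sum.inr _) => False
  | Sum.inr (Sum.inr _), Sum.inr (Sum.inl _) => False
  | _, _ => True

/-- This expresses the second moment of the number of extensions of (x, y, z) as a configuration
count. -/
lemma triConf_doubleRel_iff {A A' B B' C C' : Type} (w w' : (A' → X) × (B' → Y) × (C' → Z))
    (x : A → X) (y : B → Y) (z : C → Z) :
    TriConf e₁₂ e₁₃ e₂₃ doubleRel doubleRel doubleRel (Sum.elim x (Sum.elim w.1 w'.1))
        (Sum.elim y (Sum.elim w.2.1 w'.2.1)) (Sum.elim z (Sum.elim w.2.2 w'.2.2))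
      ↔ ExtConf e₁₂ e₁₃ e₂₃ w x y z ∧ ExtConf e₁₂ e₁₃ e₂₃ w' x y z := by
  simp only [ExtConf, TriConf, Sum.forall, doubleRel, Sum.elim_inl, Sum.elim_inr, true_imp_iff,
    false_imp_iff, forall_and, implies_true, and_true, true_and]
  tauto

variable [Fintype X] [Fintype Y] [Fintype Z]

lemma sum_ind_eq_card {S : Type*} [Fintype S] (P : S → Prop) :
    ∑ s, ind (P s) = (Nat.card {s // P s} : ℝ) := by
  classical
  simp only [ind]
  rw [Finset.sum_boole, Nat.card_eq_fintype_card, Fintype.card_subtype]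

lemma TriPseudorandom.abs_sum_sub_le (hP : TriPseudorandom e₁₂ e₁₃ e₂₃ a d δ N)
    {I J K : Type} [Fintype I] [Fintype J] [Fintype K] [DecidableEq I] [DecidableEq J]
    [DecidableEq K] (hI : Fintype.card I ≤ N) (hJ : Fintype.card J ≤ N) (hK : Fintype.card K ≤ N)
    (r₁₂ : I → J → Prop) (r₁₃ : I → K → Prop) (r₂₃ : J → K → Prop) :
    |∑ x : I → X, ∑ y : J → Y, ∑ z : K → Z, ind (TriConf e₁₂ e₁₃ e₂₃ r₁₂ r₁₃ r₂₃ x y z)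
      - triMain a d r₁₂ r₁₃ r₂₃| ≤ δ * triMain a d r₁₂ r₁₃ r₂₃ := by
  have h := hP I J K hI hJ hK r₁₂ r₁₃ r₂₃
  rw [← sum_ind_eq_card] at h
  simpa only [Fintype.sum_prod_type] using h

/-- The expected number of complete tripartite configurations with class sizes `i`, `j`, `k`. -/
def completeMain (a d : ℝ) (i j k : ℕ) : ℝ := a ^ (i + j + k) * d ^ (i * j + i * k + j * k)

lemma triMain_true (I J K : Type) [Fintype I] [Fintype J] [Fintype K] :
    triMain a d (fun (_ : I) (_ : J) => True) (fun (_ : I) (_ : K) => True)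
      (fun (_ : J) (_ : K) => True)
      = completeMain a d (Fintype.card I) (Fintype.card J) (Fintype.card K) := by
  simp only [triMain, completeMain, if_true, Finset.prod_const, Finset.card_univ, ← pow_mul,
    ← pow_add]
  congr 2
  ring

/-- Splitting off some of the vertices of a configuration. -/
lemma sum_sumArrow₃ {A A' B B' C C' : Type} [Fintype A] [Fintype A'] [Fintype B] [Fintype B']
    [Fintype C] [Fintype C'] [DecidableEq A] [DecidableEq A'] [DecidableEq B] [DecidableEq B']
    [DecidableEq C] [DecidableEq C'] (F : (A ⊕ A' → X) → (B ⊕ B' → Y) → (C ⊕ C' → Z) → ℝ) :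
    ∑ x, ∑ y, ∑ z, F x y z = ∑ w : (A' → X) × (B' → Y) × (C' → Z),
      ∑ x : A → X, ∑ y : B → Y, ∑ z : C → Z,
        F (Sum.elim x w.1) (Sum.elim y w.2.1) (Sum.elim z w.2.2) := by
  let G : ((A → X) × (A' → X)) × ((B → Y) × (B' → Y)) × ((C → Z) × (C' → Z)) → ℝ :=
    fun t => F (Sum.elim t.1.1 t.1.2) (Sum.elim t.2.1.1 t.2.1.2) (Sum.elim t.2.2.1 t.2.2.2)
  let H : ((A' → X) × (B' → Y) × (C' → Z)) × (A → X) × (B → Y) × (C → Z) → ℝ := fun t =>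
    F (Sum.elim t.2.1 t.1.1) (Sum.elim t.2.2.1 t.1.2.1) (Sum.elim t.2.2.2 t.1.2.2)
  have h : ∑ t, G t = ∑ t, H t := Fintype.sum_equiv
    { toFun := fun t => ((t.1.2, t.2.1.2, t.2.2.2), (t.1.1, t.2.1.1, t.2.2.1))
      invFun := fun t => ((t.2.1, t.1.1), (t.2.2.1, t.1.2.1), (t.2.2.2, t.1.2.2))
      left_inv := fun _ => rfl
      right_inv := fun _ => rfl } _ _ fun _ => rfl
  simp only [sum_sumArrow]
  simpa only [G, H, Fintype.sum_prod_type] using h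

lemma TriPseudorandom.abs_sum_extConf_sub_le (hP : TriPseudorandom e₁₂ e₁₃ e₂₃ a d δ N)
    {A A' B B' C C' : Type} [Fintype A] [Fintype A'] [Fintype B] [Fintype B']
    [Fintype C] [Fintype C'] [DecidableEq A] [DecidableEq A'] [DecidableEq B] [DecidableEq B']
    [DecidableEq C] [DecidableEq C']
    (hA : Fintype.card A + Fintype.card A' ≤ N) (hB : Fintype.card B + Fintype.card B' ≤ N)
    (hC : Fintype.card C + Fintype.card C' ≤ N) {M : ℝ}
    (hM : completeMain a d (Fintype.card A + Fintype.card A') (Fintype.card B + Fintype.card B')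
      (Fintype.card C + Fintype.card C') = M) :
    |∑ w : (A' → X) × (B' → Y) × (C' → Z), ∑ x : A → X, ∑ y : B → Y, ∑ z : C → Z,
      ind (ExtConf e₁₂ e₁₃ e₂₃ w x y z) - M| ≤ δ * M := by
  have h := hP.abs_sum_sub_le (I := A ⊕ A') (J := B ⊕ B') (K := C ⊕ C') (by simpa) (by simpa)
    (by simpa) (fun _ _ => True) (fun _ _ => True) (fun _ _ => True)
  rw [triMain_true, sum_sumArrow₃] at h
  simp only [Fintype.card_sum, hM] at h
  exact h

open Classical in
lemma prod_doubleRel {A A' B B' : Type} [Fintype A] [Fintype A'] [Fintype B] [Fintype B'] :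
    ∏ i : A ⊕ (A' ⊕ A'), ∏ j : B ⊕ (B' ⊕ B'), (if doubleRel i j then d else 1)
      = d ^ (Fintype.card A * Fintype.card B + 2 * (Fintype.card A * Fintype.card B')
        + 2 * (Fintype.card A' * Fintype.card B) + 2 * (Fintype.card A' * Fintype.card B')) := by
  have h₁ : ∀ (i : A) (j : B ⊕ (B' ⊕ B')), (if doubleRel (A' := A') (Sum.inl i) j then d else 1)
      = d := fun i j => if_pos trivial
  have h₂ : ∀ (i : A' ⊕ A') (j : B), (if doubleRel (A := A) (B' := B') (Sum.inr i) (Sum.inl j)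
      then d else 1) = d := fun i j => if_pos (by rcases i with i | i <;> trivial)
  have h₃ : ∀ (i : A') (j : B'), (if doubleRel (A := A) (B := B) (Sum.inr (Sum.inl i))
      (Sum.inr (Sum.inl j)) then d else 1) = d := fun i j => if_pos trivial
  have h₄ : ∀ (i : A') (j : B'), (if doubleRel (A := A) (B := B) (Sum.inr (Sum.inr i))
      (Sum.inr (Sum.inr j)) then d else 1) = d := fun i j => if_pos trivial
  have h₅ : ∀ (i : A') (j : B'), (if doubleRel (A := A) (B := B) (Sum.inr (Sum.inl i))
      (Sum.inr (Sum.inr j)) then d else 1) = 1 := fun i j => if_neg id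
  have h₆ : ∀ (i : A') (j : B'), (if doubleRel (A := A) (B := B) (Sum.inr (Sum.inr i))
      (Sum.inr (Sum.inl j)) then d else 1) = 1 := fun i j => if_neg id
  simp only [Fintype.prod_sum_type, h₁, h₂, h₃, h₄, h₅, h₆, Finset.prod_const, Finset.card_univ,
    one_pow]
  ring

/-- Two copies glued along a common part contain that part once instead of twice, and have no edges
between the copies. -/
lemma triMain_doubleRel {A A' B B' C C' : Type} [Fintype A] [Fintype A'] [Fintype B] [Fintype B']
    [Fintype C] [Fintype C'] :
    triMain a d (doubleRel : A ⊕ (A' ⊕ A') → B ⊕ (B' ⊕ B') → Prop)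
        (doubleRel : A ⊕ (A' ⊕ A') → C ⊕ (C' ⊕ C') → Prop) doubleRel
        * completeMain a d (Fintype.card A) (Fintype.card B) (Fintype.card C)
      = completeMain a d (Fintype.card A + Fintype.card A') (Fintype.card B + Fintype.card B')
        (Fintype.card C + Fintype.card C') ^ 2 := by
  simp only [triMain, completeMain, prod_doubleRel, Fintype.card_sum]
  ring

/-- Almost all complete (2, 2, 2)-configurations have about M / M₀ extensions, by a variance
estimate. The extra vertices `w` can thus be summed out against any bounded φ. -/
lemma TriPseudorandom.abs_sum_extConf_mul_sub_le (hP : TriPseudorandom e₁₂ e₁₃ e₂₃ a d δ N)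
    (ha : 0 < a) (hd : 0 < d) (hδ₀ : 0 ≤ δ) (hδ₁ : δ ≤ 1)
    {I J K : Type} [Fintype I] [Fintype J] [Fintype K] [DecidableEq I] [DecidableEq J]
    [DecidableEq K] (hI : 2 + 2 * Fintype.card I ≤ N) (hJ : 2 + 2 * Fintype.card J ≤ N)
    (hK : 2 + 2 * Fintype.card K ≤ N)
    (φ : (Fin 2 → X) → (Fin 2 → Y) → (Fin 2 → Z) → ℝ) (hφ : ∀ x y z, |φ x y z| ≤ 1) {M₀ M : ℝ}
    (hM₀ : completeMain a d 2 2 2 = M₀)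
    (hM : completeMain a d (2 + Fintype.card I) (2 + Fintype.card J) (2 + Fintype.card K) = M) :
    |∑ w : (I → X) × (J → Y) × (K → Z), ∑ x, ∑ y, ∑ z, ind (ExtConf e₁₂ e₁₃ e₂₃ w x y z) * φ x y z
      - M / M₀ * ∑ x, ∑ y, ∑ z, ind (TriConf e₁₂ e₁₃ e₂₃ (fun _ _ => True) (fun _ _ => True)
        (fun _ _ => True) x y z) * φ x y z| ≤ √(8 * δ) * M := by
  have hM₀p : 0 < M₀ := by
    rw [← hM₀, completeMain]
    positivity
  have hMp : 0 < M := by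
    rw [← hM, completeMain]
    positivity
  set κ := M / M₀
  have hκ : κ * M₀ = M := div_mul_cancel₀ _ hM₀p.ne'
  let S := (Fin 2 → X) × (Fin 2 → Y) × (Fin 2 → Z)
  let β : S → ℝ := fun s => ind (TriConf e₁₂ e₁₃ e₂₃ (fun _ _ => True) (fun _ _ => True)
    (fun _ _ => True) s.1 s.2.1 s.2.2)
  let W : S → ℝ := fun s => ∑ w : (I → X) × (J → Y) × (K → Z),
    ind (ExtConf e₁₂ e₁₃ e₂₃ w s.1 s.2.1 s.2.2)
  have hββ : ∀ s, β s * β s = β s := fun s => by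
    simp only [β, ind_mul, and_self]
  have hβW : ∀ s, W s * β s = W s := fun s => by
    simp only [β, W, Finset.sum_mul]
    refine Finset.sum_congr rfl fun w _ => ?_
    rw [ind_mul]
    refine ind_congr ⟨And.left, fun h => ⟨h, ?_⟩⟩
    simp only [ExtConf, TriConf, Sum.forall, Sum.elim_inl, Sum.elim_inr, true_imp_iff,
      forall_and] at h ⊢
    tauto
  have hβ0 : ∀ s, 0 ≤ β s := fun s => ind_nonneg _
  have h₀ : |∑ s, β s - M₀| ≤ δ * M₀ := by
    have := hP.abs_sum_sub_le (I := Fin 2) (J := Fin 2) (K := Fin 2) (by simp; omega)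
      (by simp; omega) (by simp; omega) (fun _ _ => True) (fun _ _ => True) (fun _ _ => True)
    rw [triMain_true] at this
    simp only [Fintype.card_fin, hM₀] at this
    simpa only [β, S, Fintype.sum_prod_type] using this
  have h₁ : |∑ s, W s - M| ≤ δ * M := by
    have := hP.abs_sum_extConf_sub_le (A := Fin 2) (A' := I) (B := Fin 2) (B' := J) (C := Fin 2)
      (C' := K) (M := M) (by simp; omega) (by simp; omega) (by simp; omega) (by simpa using hM)
    have h2 : ∑ s, W s = ∑ w : (I → X) × (J → Y) × (K → Z), ∑ x : Fin 2 → X, ∑ y : Fin 2 → Y,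
        ∑ z : Fin 2 → Z, ind (ExtConf e₁₂ e₁₃ e₂₃ w x y z) := by
      simp only [W]
      rw [Finset.sum_comm]
      simp only [S, Fintype.sum_prod_type]
    rwa [h2]
  -- The second moment needs two copies of `w` together with the common part, hence the hypotheses 2
  -- + 2|I| ≤ N.
  have h₂ : |∑ s, W s ^ 2 - κ * M| ≤ δ * (κ * M) := by
    have := hP.abs_sum_sub_le (I := Fin 2 ⊕ (I ⊕ I)) (J := Fin 2 ⊕ (J ⊕ J))
      (K := Fin 2 ⊕ (K ⊕ K)) (by simp; omega)
      (by simp; omega) (by simp; omega) doubleRel doubleRel doubleRel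
    have hmain : triMain a d (doubleRel : Fin 2 ⊕ (I ⊕ I) → Fin 2 ⊕ (J ⊕ J) → Prop)
        (doubleRel : Fin 2 ⊕ (I ⊕ I) → Fin 2 ⊕ (K ⊕ K) → Prop) doubleRel = κ * M := by
      have h := triMain_doubleRel (a := a) (d := d) (A := Fin 2) (A' := I) (B := Fin 2) (B' := J)
        (C := Fin 2) (C' := K)
      simp only [Fintype.card_fin, hM₀, hM] at h
      rw [div_mul_eq_mul_div, eq_div_iff hM₀p.ne', h, sq]
    rw [hmain, sum_sumArrow₃] at this
    have h2 : ∑ s, W s ^ 2 = ∑ w : (I ⊕ I → X) × (J ⊕ J → Y) × (K ⊕ K → Z),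
        ∑ x : Fin 2 → X, ∑ y : Fin 2 → Y, ∑ z : Fin 2 → Z,
          ind (TriConf e₁₂ e₁₃ e₂₃ doubleRel doubleRel doubleRel (Sum.elim x w.1)
            (Sum.elim y w.2.1) (Sum.elim z w.2.2)) := by
      have h3 : ∀ s : S, W s ^ 2 = ∑ w : (I ⊕ I → X) × (J ⊕ J → Y) × (K ⊕ K → Z),
          ind (TriConf e₁₂ e₁₃ e₂₃ doubleRel doubleRel doubleRel (Sum.elim s.1 w.1)
            (Sum.elim s.2.1 w.2.1) (Sum.elim s.2.2 w.2.2)) := by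
        intro s
        have h4 := sum_sumArrow₃ (A := I) (A' := I) (B := J) (B' := J) (C := K) (C' := K)
          (fun x y z => ind (TriConf e₁₂ e₁₃ e₂₃ doubleRel doubleRel doubleRel (Sum.elim s.1 x)
            (Sum.elim s.2.1 y) (Sum.elim s.2.2 z)))
        rw [Fintype.sum_prod_type]
        simp only [Fintype.sum_prod_type (α₁ := J ⊕ J → Y)]
        rw [h4, sq]
        simp only [W]
        rw [Finset.sum_mul_sum, Finset.sum_comm]
        refine Finset.sum_congr rfl fun w' _ => ?_
        rw [Fintype.sum_prod_type]
        simp only [Fintype.sum_prod_type (α₁ := J → Y)]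
        refine Finset.sum_congr rfl fun x _ => Finset.sum_congr rfl fun y _ =>
          Finset.sum_congr rfl fun z _ => ?_
        rw [ind_mul]
        exact ind_congr (triConf_doubleRel_iff (x, y, z) w' s.1 s.2.1 s.2.2).symm
      simp only [h3]
      rw [Finset.sum_comm]
      simp only [S, Fintype.sum_prod_type (α₁ := Fin 2 → X), Fintype.sum_prod_type (α₁ := Fin 2 → Y)]
    rw [h2]
    exact this
  have hvar : ∑ s, (W s - κ * β s) ^ 2 ≤ 4 * δ * (κ * M) := by
    have : ∑ s, (W s - κ * β s) ^ 2 = ∑ s, W s ^ 2 - 2 * κ * ∑ s, W s + κ ^ 2 * ∑ s, β s := by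
      rw [Finset.mul_sum, Finset.mul_sum, ← Finset.sum_sub_distrib, ← Finset.sum_add_distrib]
      refine Finset.sum_congr rfl fun s _ => ?_
      linear_combination (-2 * κ) * hβW s + κ ^ 2 * hββ s
    rw [this]
    have hκ0 : 0 < κ := div_pos hMp hM₀p
    have i₀ := (abs_le.1 h₀).2
    have i₁ := (abs_le.1 h₁).1
    have i₂ := (abs_le.1 h₂).2
    have j₀ := mul_le_mul_of_nonneg_left i₀ (sq_nonneg κ)
    have j₁ := mul_le_mul_of_nonneg_left i₁ hκ0.le
    have hκ2 : κ ^ 2 * M₀ = κ * M := by rw [sq, mul_assoc, hκ]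
    nlinarith [j₀, j₁, i₂, hκ2]
  -- The deviation is supported on `β`, so Cauchy–Schwarz is taken against `β`. It costs 2M₀ rather
  -- than the number of all sextuples.
  have habs : (∑ s, |W s - κ * β s|) ^ 2 ≤ 8 * δ * M ^ 2 := by
    have hcs : (∑ s, |W s - κ * β s|) ^ 2 ≤ (∑ s, β s) * ∑ s, (W s - κ * β s) ^ 2 := by
      refine Finset.sum_sq_le_sum_mul_sum_of_sq_le_mul _ (fun s _ => hβ0 s)
        (fun s _ => sq_nonneg _) fun s _ => le_of_eq ?_
      rw [sq_abs]
      have : W s - κ * β s = (W s - κ * β s) * β s := by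
        linear_combination -hβW s + κ * hββ s
      calc (W s - κ * β s) ^ 2 = (W s - κ * β s) * (W s - κ * β s) := sq _
        _ = ((W s - κ * β s) * β s) * (W s - κ * β s) := by rw [← this]
        _ = _ := by ring
    have hβs : ∑ s, β s ≤ 2 * M₀ := by
      have := (abs_le.1 h₀).2
      nlinarith
    calc _ ≤ _ := hcs
      _ ≤ (2 * M₀) * (4 * δ * (κ * M)) := by
          refine mul_le_mul hβs hvar (Finset.sum_nonneg fun s _ => sq_nonneg _) (by positivity)
      _ = _ := by
          rw [← hκ]
          ring
  have hfinal : ∑ s, |W s - κ * β s| ≤ √(8 * δ) * M := by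
    refine le_of_sq_le_sq ?_ (by positivity)
    rw [mul_pow, Real.sq_sqrt (by positivity)]
    exact habs
  refine le_trans ?_ hfinal
  have e₁ : ∑ w : (I → X) × (J → Y) × (K → Z), ∑ x, ∑ y, ∑ z,
      ind (ExtConf e₁₂ e₁₃ e₂₃ w x y z) * φ x y z = ∑ s : S, W s * φ s.1 s.2.1 s.2.2 := by
    simp only [W, Finset.sum_mul]
    symm
    rw [Finset.sum_comm]
    simp only [S, Fintype.sum_prod_type (α₁ := Fin 2 → X), Fintype.sum_prod_type (α₁ := Fin 2 → Y)]
  have e₂ : ∑ x, ∑ y, ∑ z, ind (TriConf e₁₂ e₁₃ e₂₃ (fun _ _ => True) (fun _ _ => True)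
        (fun _ _ => True) x y z) * φ x y z = ∑ s : S, β s * φ s.1 s.2.1 s.2.2 := by
    simp only [β, S, Fintype.sum_prod_type]
  rw [e₁, e₂, Finset.mul_sum, ← Finset.sum_sub_distrib]
  refine (Finset.abs_sum_le_sum_abs _ _).trans (Finset.sum_le_sum fun s _ => ?_)
  rw [← mul_assoc, ← sub_mul, abs_mul]
  exact mul_le_of_le_one_right (abs_nonneg _) (hφ _ _ _)

end

/-! ### The generalized von Neumann inequality. -/

section

variable {X Y Z : Type*} [Fintype X] [Fintype Y] [Fintype Z]
  {e₁₂ : X → Y → Prop} {e₁₃ : X → Z → Prop} {e₂₃ : Y → Z → Prop} {a d δ : ℝ} {N : ℕ}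

lemma abs_ind_mul_le (P : Prop) {t : ℝ} (ht : |t| ≤ 1) : |ind P * t| ≤ ind P := by
  rw [abs_mul, abs_of_nonneg (ind_nonneg P)]
  exact mul_le_of_le_one_right (ind_nonneg P) ht

/-- A generalized von Neumann inequality: in a pseudorandom tripartite graph, the local box norm
of `f` controls averages over configurations of products in which `f` is the only factor that
depends on all three of the vertices `x`, `y`, `z`. -/
lemma TriPseudorandom.generalized_von_neumann (hP : TriPseudorandom e₁₂ e₁₃ e₂₃ a d δ N)
    (ha : 0 < a) (hd : 0 < d) (hδ₀ : 0 ≤ δ) (hδ₁ : δ ≤ 1)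
    {I J K : Type} [Fintype I] [Fintype J] [Fintype K] [DecidableEq I] [DecidableEq J]
    [DecidableEq K] (hI : 2 + 2 * Fintype.card I ≤ N) (hJ : 2 + 2 * Fintype.card J ≤ N)
    (hK : 2 + 2 * Fintype.card K ≤ N)
    (f : X → Y → Z → ℝ) (hf : ∀ x y z, |f x y z| ≤ 1)
    (g : (I → X) × (J → Y) × (K → Z) → X → Y → ℝ) (hg : ∀ w x y, |g w x y| ≤ 1)
    (h : (I → X) × (J → Y) × (K → Z) → X → Z → ℝ) (hh : ∀ w x z, |h w x z| ≤ 1)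
    (k : (I → X) × (J → Y) × (K → Z) → Y → Z → ℝ) (hk : ∀ w y z, |k w y z| ≤ 1)
    {τ : ℝ} (hτ : 0 ≤ τ)
    (hT : ∑ x : Fin 2 → X, ∑ y : Fin 2 → Y, ∑ z : Fin 2 → Z, ind (TriConf e₁₂ e₁₃ e₂₃
        (fun _ _ => True) (fun _ _ => True) (fun _ _ => True) x y z)
        * ∏ i, ∏ j, ∏ l, f (x i) (y j) (z l) ≤ τ * completeMain a d 2 2 2) :
    (∑ w : (I → X) × (J → Y) × (K → Z), ∑ x, ∑ y, ∑ z,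
      ind (ExtConf e₁₂ e₁₃ e₂₃ w (fun _ : Unit => x) (fun _ : Unit => y) (fun _ : Unit => z))
        * (f x y z * g w x y * h w x z * k w y z)) ^ 8
      ≤ 2 ^ 7 * (τ + √(8 * δ)) * completeMain a d (1 + Fintype.card I) (1 + Fintype.card J)
        (1 + Fintype.card K) ^ 8 := by
  -- The configuration indicator is distributed over three weights, each omitting one of x, y, z.
  -- Using `Empty` for the omitted class makes these weights `ExtConf` indicators as well, so their
  -- sums are again pseudorandom counts.
  let G : (I → X) × (J → Y) × (K → Z) → X → Y → ℝ := fun w x y =>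
    ind (ExtConf e₁₂ e₁₃ e₂₃ w (fun _ : Unit => x) (fun _ : Unit => y) fun e : Empty => e.elim)
  let H : (I → X) × (J → Y) × (K → Z) → X → Z → ℝ := fun w x z =>
    ind (ExtConf e₁₂ e₁₃ e₂₃ w (fun _ : Unit => x) (fun e : Empty => e.elim) fun _ : Unit => z)
  let L : (I → X) × (J → Y) × (K → Z) → Y → Z → ℝ := fun w y z =>
    ind (ExtConf e₁₂ e₁₃ e₂₃ w (fun e : Empty => e.elim) (fun _ : Unit => y) fun _ : Unit => z)
  have hpos : ∀ i j l, 0 < completeMain a d i j l := fun i j l => by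
    unfold completeMain
    positivity
  have hcs := gowers_cauchy_schwarz f (fun w x y => G w x y * g w x y) G
    (fun w x z => H w x z * h w x z) H (fun w y z => L w y z * k w y z) L
    (fun w x y => abs_ind_mul_le _ (hg w x y)) (fun w x z => abs_ind_mul_le _ (hh w x z))
    (fun w y z => abs_ind_mul_le _ (hk w y z))
  have e₀ : ∑ w, ∑ x, ∑ y, ∑ z, f x y z * (G w x y * g w x y) * (H w x z * h w x z)
        * (L w y z * k w y z)
      = ∑ w : (I → X) × (J → Y) × (K → Z), ∑ x, ∑ y, ∑ z,
      ind (ExtConf e₁₂ e₁₃ e₂₃ w (fun _ : Unit => x) (fun _ : Unit => y) (fun _ : Unit => z))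
        * (f x y z * g w x y * h w x z * k w y z) := by
    refine Finset.sum_congr rfl fun w _ => Finset.sum_congr rfl fun x _ =>
      Finset.sum_congr rfl fun y _ => Finset.sum_congr rfl fun z _ => ?_
    have : G w x y * H w x z * L w y z = ind (ExtConf e₁₂ e₁₃ e₂₃ w (fun _ : Unit => x)
        (fun _ : Unit => y) (fun _ : Unit => z)) := by
      simp only [G, H, L, ind_mul]
      refine ind_congr ?_
      simp only [ExtConf, TriConf, Sum.forall, Sum.elim_inl, Sum.elim_inr,
        forall_and, IsEmpty.forall_iff, forall_const]
      tauto
    rw [← this]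
    ring
  have e₁ : ∀ w (x : Fin 2 → X) z, H w (x 0) z * H w (x 1) z
      = ind (ExtConf e₁₂ e₁₃ e₂₃ w x (fun e : Empty => e.elim) (fun _ : Unit => z)) := by
    intro w x z
    simp only [H, ind_mul]
    refine ind_congr ?_
    simp only [ExtConf, TriConf, Sum.forall, Sum.elim_inl, Sum.elim_inr,
      forall_and, IsEmpty.forall_iff, forall_const, Fin.forall_fin_two]
    tauto
  have e₂ : ∀ w (x : Fin 2 → X) (y : Fin 2 → Y),
      (G w (x 0) (y 0) * G w (x 1) (y 0)) * (G w (x 0) (y 1) * G w (x 1) (y 1))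
      = ind (ExtConf e₁₂ e₁₃ e₂₃ w x y (fun e : Empty => e.elim)) := by
    intro w x y
    simp only [G, ind_mul]
    refine ind_congr ?_
    simp only [ExtConf, TriConf, Sum.forall, Sum.elim_inl, Sum.elim_inr,
      forall_and, IsEmpty.forall_iff, forall_const, Fin.forall_fin_two]
    tauto
  have e₃ : ∀ w (x : Fin 2 → X) (y : Fin 2 → Y) (z : Fin 2 → Z),
      (G w (x 0) (y 0) * G w (x 1) (y 0)) * (G w (x 0) (y 1) * G w (x 1) (y 1))
        * ((H w (x 0) (z 0) * H w (x 1) (z 0)) * (L w (y 0) (z 0) * L w (y 1) (z 0)))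
        * ((H w (x 0) (z 1) * H w (x 1) (z 1)) * (L w (y 0) (z 1) * L w (y 1) (z 1)))
      = ind (ExtConf e₁₂ e₁₃ e₂₃ w x y z) := by
    intro w x y z
    rw [e₂, e₁, e₁]
    simp only [L, ind_mul]
    refine ind_congr ?_
    simp only [ExtConf, TriConf, Sum.forall, Sum.elim_inl, Sum.elim_inr,
      forall_and, IsEmpty.forall_iff, forall_const, Fin.forall_fin_two]
    tauto
  rw [e₀] at hcs
  simp only [e₃] at hcs
  simp only [e₁, e₂] at hcs
  have upper : ∀ {S M : ℝ}, |S - M| ≤ δ * M → 0 < M → S ≤ 2 * M := fun hS hM => by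
    have := (abs_le.1 hS).2
    nlinarith
  have hA := hP.abs_sum_extConf_sub_le (A := Empty) (A' := I) (B := Unit) (B' := J) (C := Unit)
    (C' := K) (by simp; omega) (by simp; omega) (by simp; omega) rfl
  have hB := hP.abs_sum_extConf_sub_le (A := Fin 2) (A' := I) (B := Empty) (B' := J) (C := Unit)
    (C' := K) (by simp; omega) (by simp; omega) (by simp; omega) rfl
  have hC := hP.abs_sum_extConf_sub_le (A := Fin 2) (A' := I) (B := Fin 2) (B' := J) (C := Empty)
    (C' := K) (by simp; omega) (by simp; omega) (by simp; omega) rfl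
  have hA2 := upper hA (hpos _ _ _)
  have hB2 := upper hB (hpos _ _ _)
  have hC2 := upper hC (hpos _ _ _)
  simp only [Fintype.sum_subsingleton _ (fun e : Empty => (e.elim : X)), sum_unitArrow,
    Fintype.card_empty, Fintype.card_unit, zero_add] at hA2
  simp only [Fintype.sum_subsingleton _ (fun e : Empty => (e.elim : Y)), sum_unitArrow,
    Fintype.card_empty, Fintype.card_unit, Fintype.card_fin, zero_add] at hB2
  simp only [Fintype.sum_subsingleton _ (fun e : Empty => (e.elim : Z)),
    Fintype.card_empty, Fintype.card_fin, zero_add] at hC2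
  have hφ : ∀ (x : Fin 2 → X) (y : Fin 2 → Y) (z : Fin 2 → Z),
      |∏ i, ∏ j, ∏ l, f (x i) (y j) (z l)| ≤ 1 := by
    intro x y z
    simp only [Finset.abs_prod]
    exact Finset.prod_le_one (fun _ _ => Finset.prod_nonneg fun _ _ => Finset.prod_nonneg
      fun _ _ => abs_nonneg _) fun _ _ => Finset.prod_le_one (fun _ _ => Finset.prod_nonneg
      fun _ _ => abs_nonneg _) fun _ _ => Finset.prod_le_one (fun _ _ => abs_nonneg _)
      fun _ _ => hf _ _ _
  have hQ := hP.abs_sum_extConf_mul_sub_le ha hd hδ₀ hδ₁ hI hJ hK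
    (fun x y z => ∏ i, ∏ j, ∏ l, f (x i) (y j) (z l)) hφ rfl rfl
  set M₀ := completeMain a d 2 2 2
  set M' := completeMain a d (2 + Fintype.card I) (2 + Fintype.card J) (2 + Fintype.card K)
  have hM₀ : 0 < M₀ := hpos _ _ _
  have hM' : 0 < M' := hpos _ _ _
  have hT' := mul_le_mul_of_nonneg_left hT (div_nonneg hM'.le hM₀.le)
  have hκ : M' / M₀ * (τ * M₀) = τ * M' := by
    field_simp
  have hQ2 := (abs_le.1 hQ).2
  have hQ3 := (sub_le_iff_le_add.1 hQ2).trans (add_le_add le_rfl (hT'.trans_eq hκ))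
  set M₁ := completeMain a d (Fintype.card I) (1 + Fintype.card J) (1 + Fintype.card K)
  set M₂ := completeMain a d (2 + Fintype.card I) (Fintype.card J) (1 + Fintype.card K)
  set M₃ := completeMain a d (2 + Fintype.card I) (2 + Fintype.card J) (Fintype.card K)
  -- All powers of `a` and `d` match, so the Cauchy–Schwarz losses are absolute constants: 2^4 · 2^2
  -- · 2 = 2^7.
  have hM : M₁ ^ 4 * M₂ ^ 2 * M₃ * M' = completeMain a d (1 + Fintype.card I)
      (1 + Fintype.card J) (1 + Fintype.card K) ^ 8 := by
    simp only [M₁, M₂, M₃, M', completeMain]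
    ring
  rw [← hM]
  have n₁ : 0 ≤ ∑ w, ∑ y, ∑ z, L w y z := Finset.sum_nonneg fun _ _ => Finset.sum_nonneg
    fun _ _ => Finset.sum_nonneg fun _ _ => ind_nonneg _
  have n₂ : 0 ≤ ∑ w : (I → X) × (J → Y) × (K → Z), ∑ x : Fin 2 → X, ∑ z, ind (ExtConf e₁₂ e₁₃ e₂₃
      w x (fun e : Empty => (e.elim : Y)) (fun _ : Unit => z)) := Finset.sum_nonneg fun _ _ =>
    Finset.sum_nonneg fun _ _ => Finset.sum_nonneg fun _ _ => ind_nonneg _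
  have n₃ : 0 ≤ ∑ w : (I → X) × (J → Y) × (K → Z), ∑ x : Fin 2 → X, ∑ y : Fin 2 → Y,
      ind (ExtConf e₁₂ e₁₃ e₂₃ w x y (fun e : Empty => (e.elim : Z))) := Finset.sum_nonneg
    fun _ _ => Finset.sum_nonneg fun _ _ => Finset.sum_nonneg fun _ _ => ind_nonneg _
  have hM₁ : 0 < M₁ := hpos _ _ _
  have hM₂ : 0 < M₂ := hpos _ _ _
  calc _ ≤ _ := hcs
    _ ≤ (2 * M₁) ^ 4 * (2 * M₂) ^ 2 * (2 * M₃) * (√(8 * δ) * M' + τ * M') := by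
        refine (mul_le_mul_of_nonneg_left hQ3 (by positivity)).trans ?_
        have : 0 ≤ √(8 * δ) * M' + τ * M' := by positivity
        gcongr
    _ = _ := by ring

end

/-! ### Replacing factors by constants, and the counting lemma. -/

/-- Singling out an element of a type. -/
def splitPoint {I : Type*} [DecidableEq I] (i₀ : I) : Unit ⊕ {i // i ≠ i₀} ≃ I where
  toFun := Sum.elim (fun _ => i₀) Subtype.val
  invFun i := if h : i = i₀ then Sum.inl () else Sum.inr ⟨i, h⟩
  left_inv := by
    rintro (_ | ⟨i, hi⟩)
    · simp
    · simp [hi]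
  right_inv i := by
    by_cases h : i = i₀ <;> simp [h]

section

variable {X Y Z : Type*} [Fintype X] [Fintype Y] [Fintype Z]
  {e₁₂ : X → Y → Prop} {e₁₃ : X → Z → Prop} {e₂₃ : Y → Z → Prop} {a d δ τ : ℝ} {N : ℕ}

/-- A factor with index in S misses the distinguished vertex of some class, so for fixed `w` it
depends on at most two of x, y, z. It goes into `g` if it misses z, otherwise into `h` if it misses
y, otherwise into `k`. -/
lemma TriPseudorandom.sum_mul_prod_le_of_sum (hP : TriPseudorandom e₁₂ e₁₃ e₂₃ a d δ N)
    (ha : 0 < a) (hd : 0 < d) (hδ₀ : 0 ≤ δ) (hδ₁ : δ ≤ 1)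
    {I J K : Type} [Fintype I] [Fintype J] [Fintype K] [DecidableEq I] [DecidableEq J]
    [DecidableEq K] (hI : 2 + 2 * Fintype.card I ≤ N) (hJ : 2 + 2 * Fintype.card J ≤ N)
    (hK : 2 + 2 * Fintype.card K ≤ N)
    (f : X → Y → Z → ℝ) (hf : ∀ x y z, |f x y z| ≤ 1) (hτ : 0 ≤ τ)
    (hT : ∑ x : Fin 2 → X, ∑ y : Fin 2 → Y, ∑ z : Fin 2 → Z, ind (TriConf e₁₂ e₁₃ e₂₃
        (fun _ _ => True) (fun _ _ => True) (fun _ _ => True) x y z)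
        * ∏ i, ∏ j, ∏ l, f (x i) (y j) (z l) ≤ τ * completeMain a d 2 2 2)
    {ι : Type*} (S : Finset ι) (F : ι → X → Y → Z → ℝ) (hF : ∀ s x y z, |F s x y z| ≤ 1)
    (u : ι → Unit ⊕ I) (v : ι → Unit ⊕ J) (t : ι → Unit ⊕ K)
    (hS : ∀ s ∈ S, ¬ (u s = Sum.inl () ∧ v s = Sum.inl () ∧ t s = Sum.inl ())) :
    (∑ x : Unit ⊕ I → X, ∑ y : Unit ⊕ J → Y, ∑ z : Unit ⊕ K → Z,
      ind (TriConf e₁₂ e₁₃ e₂₃ (fun _ _ => True) (fun _ _ => True) (fun _ _ => True) x y z)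
        * (f (x (Sum.inl ())) (y (Sum.inl ())) (z (Sum.inl ()))
          * ∏ s ∈ S, F s (x (u s)) (y (v s)) (z (t s)))) ^ 8
      ≤ 2 ^ 7 * (τ + √(8 * δ)) * completeMain a d (1 + Fintype.card I) (1 + Fintype.card J)
        (1 + Fintype.card K) ^ 8 := by
  have hprod : ∀ c : ι → ℝ, (∀ s, |c s| ≤ 1) → |∏ s ∈ S, c s| ≤ 1 := fun c hc => by
    rw [Finset.abs_prod]
    exact Finset.prod_le_one (fun _ _ => abs_nonneg _) fun s _ => hc s
  have h1 : |(1 : ℝ)| ≤ 1 := by simp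
  let g : (I → X) × (J → Y) × (K → Z) → X → Y → ℝ := fun w x y => ∏ s ∈ S,
    Sum.elim (fun _ => 1) (fun k => F s (Sum.elim (fun _ : Unit => x) w.1 (u s))
      (Sum.elim (fun _ : Unit => y) w.2.1 (v s)) (w.2.2 k)) (t s)
  let h : (I → X) × (J → Y) × (K → Z) → X → Z → ℝ := fun w x z => ∏ s ∈ S,
    Sum.elim (fun _ => Sum.elim (fun _ => 1)
      (fun j => F s (Sum.elim (fun _ : Unit => x) w.1 (u s)) (w.2.1 j) z) (v s)) (fun _ => 1) (t s)
  let k : (I → X) × (J → Y) × (K → Z) → Y → Z → ℝ := fun w y z => ∏ s ∈ S,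
    Sum.elim (fun _ => Sum.elim (fun _ => Sum.elim (fun _ => 1) (fun i => F s (w.1 i) y z) (u s))
      (fun _ => 1) (v s)) (fun _ => 1) (t s)
  have hg : ∀ w x y, |g w x y| ≤ 1 := fun w x y => hprod _ fun s => by
    rcases t s with _ | _
    · exact h1
    · exact hF _ _ _ _
  have hh : ∀ w x z, |h w x z| ≤ 1 := fun w x y => hprod _ fun s => by
    rcases t s with _ | _ <;> rcases v s with _ | _
    · exact h1
    · exact hF _ _ _ _
    · exact h1
    · exact h1
  have hk : ∀ w y z, |k w y z| ≤ 1 := fun w x y => hprod _ fun s => by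
    rcases t s with _ | _ <;> rcases v s with _ | _ <;> rcases u s with _ | _
    · exact h1
    · exact hF _ _ _ _
    all_goals exact h1
  have hvN := hP.generalized_von_neumann ha hd hδ₀ hδ₁ hI hJ hK f hf g hg h hh k hk hτ hT
  refine le_trans (le_of_eq ?_) hvN
  congr 1
  rw [sum_sumArrow₃]
  simp only [sum_unitArrow, Sum.elim_inl]
  refine Finset.sum_congr rfl fun w _ => Finset.sum_congr rfl fun x _ =>
      Finset.sum_congr rfl fun y _ => Finset.sum_congr rfl fun z _ => ?_
  have : ∏ s ∈ S, F s (Sum.elim (fun _ : Unit => x) w.1 (u s))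
      (Sum.elim (fun _ : Unit => y) w.2.1 (v s)) (Sum.elim (fun _ : Unit => z) w.2.2 (t s))
      = g w x y * h w x z * k w y z := by
    simp only [g, h, k, ← Finset.prod_mul_distrib]
    refine Finset.prod_congr rfl fun s hs => ?_
    have := hS s hs
    revert this
    rcases t s with ⟨⟨⟩⟩ | _ <;> rcases v s with ⟨⟨⟩⟩ | _ <;> rcases u s with ⟨⟨⟩⟩ | _ <;> simp
  rw [this, ExtConf]
  ring

/-- Any triple `s₀` can be made the distinguished one by relabelling with `splitPoint`. Removing its
vertices turns 2|I| into 2 + 2(|I| - 1). -/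
lemma TriPseudorandom.sum_mul_prod_le (hP : TriPseudorandom e₁₂ e₁₃ e₂₃ a d δ N)
    (ha : 0 < a) (hd : 0 < d) (hδ₀ : 0 ≤ δ) (hδ₁ : δ ≤ 1)
    {I J K : Type} [Fintype I] [Fintype J] [Fintype K] [DecidableEq I] [DecidableEq J]
    [DecidableEq K] (hI : 2 * Fintype.card I ≤ N) (hJ : 2 * Fintype.card J ≤ N)
    (hK : 2 * Fintype.card K ≤ N)
    (f : X → Y → Z → ℝ) (hf : ∀ x y z, |f x y z| ≤ 1) (hτ : 0 ≤ τ)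
    (hT : ∑ x : Fin 2 → X, ∑ y : Fin 2 → Y, ∑ z : Fin 2 → Z, ind (TriConf e₁₂ e₁₃ e₂₃
        (fun _ _ => True) (fun _ _ => True) (fun _ _ => True) x y z)
        * ∏ i, ∏ j, ∏ l, f (x i) (y j) (z l) ≤ τ * completeMain a d 2 2 2)
    (F : I × J × K → X → Y → Z → ℝ) (hF : ∀ s x y z, |F s x y z| ≤ 1)
    (S : Finset (I × J × K)) (s₀ : I × J × K) (hS : s₀ ∉ S) :
    (∑ x : I → X, ∑ y : J → Y, ∑ z : K → Z,
      ind (TriConf e₁₂ e₁₃ e₂₃ (fun _ _ => True) (fun _ _ => True) (fun _ _ => True) x y z)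
        * (f (x s₀.1) (y s₀.2.1) (z s₀.2.2)
          * ∏ s ∈ S, F s (x s.1) (y s.2.1) (z s.2.2))) ^ 8
      ≤ 2 ^ 7 * (τ + √(8 * δ)) * completeMain a d (Fintype.card I) (Fintype.card J)
        (Fintype.card K) ^ 8 := by
  obtain ⟨i₀, j₀, k₀⟩ := s₀
  have hcard : ∀ {T : Type} [Fintype T] [DecidableEq T] (t₀ : T),
      1 + Fintype.card {t // t ≠ t₀} = Fintype.card T := fun {T} _ _ t₀ => by
    rw [← Fintype.card_congr (splitPoint t₀), Fintype.card_sum, Fintype.card_unit]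
  have h := hP.sum_mul_prod_le_of_sum ha hd hδ₀ hδ₁ (I := {i // i ≠ i₀}) (J := {j // j ≠ j₀})
    (K := {k // k ≠ k₀}) (by have := hcard i₀; omega) (by have := hcard j₀; omega)
    (by have := hcard k₀; omega) f hf hτ hT S F hF (fun s => (splitPoint i₀).symm s.1)
    (fun s => (splitPoint j₀).symm s.2.1) (fun s => (splitPoint k₀).symm s.2.2) (by
      rintro ⟨i, j, k⟩ hs ⟨h₁, h₂, h₃⟩
      rw [Equiv.symm_apply_eq] at h₁ h₂ h₃
      have e : (i, j, k) = (i₀, j₀, k₀) := by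
        simp only [Prod.mk.injEq]
        exact ⟨h₁, h₂, h₃⟩
      exact hS (e ▸ hs))
  rw [hcard, hcard, hcard] at h
  refine le_trans (le_of_eq ?_) h
  congr 1
  symm
  refine Fintype.sum_equiv ((splitPoint i₀).arrowCongr (Equiv.refl X)) _ _ fun x => ?_
  refine Fintype.sum_equiv ((splitPoint j₀).arrowCongr (Equiv.refl Y)) _ _ fun y => ?_
  refine Fintype.sum_equiv ((splitPoint k₀).arrowCongr (Equiv.refl Z)) _ _ fun z => ?_
  have hpt : ∀ {T : Type} [DecidableEq T] (t₀ : T), (splitPoint t₀).symm t₀ = Sum.inl () :=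
    fun t₀ => by
      rw [Equiv.symm_apply_eq]
      rfl
  have hfa : ∀ {A A' B B' : Type} (e : A ≃ A') (e' : B ≃ B') (P : A → B → Prop),
      (∀ i j, P (e.symm i) (e'.symm j)) ↔ ∀ i j, P i j := fun e e' P =>
    ⟨fun h i j => by simpa using h (e i) (e' j), fun h i j => h _ _⟩
  have hind : ind (TriConf e₁₂ e₁₃ e₂₃ (fun _ _ => True) (fun _ _ => True) (fun _ _ => True)
      ((splitPoint i₀).arrowCongr (Equiv.refl X) x) ((splitPoint j₀).arrowCongr (Equiv.refl Y) y)
      ((splitPoint k₀).arrowCongr (Equiv.refl Z) z))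
      = ind (TriConf e₁₂ e₁₃ e₂₃ (fun _ _ => True) (fun _ _ => True) (fun _ _ => True) x y z) := by
    refine ind_congr ?_
    simp only [TriConf, true_imp_iff]
    exact and_congr (hfa (splitPoint i₀) (splitPoint j₀) fun i j => e₁₂ (x i) (y j))
      (and_congr (hfa (splitPoint i₀) (splitPoint k₀) fun i k => e₁₃ (x i) (z k))
        (hfa (splitPoint j₀) (splitPoint k₀) fun j k => e₂₃ (y j) (z k)))
  rw [hind]
  simp only [Equiv.arrowCongr_apply, Equiv.coe_refl, Function.comp_def, id, hpt]

/-- Every pattern of a system of functions with the same uniform part occurs. -/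
lemma TriPseudorandom.exists_pattern (hP : TriPseudorandom e₁₂ e₁₃ e₂₃ a d δ N)
    (ha : 0 < a) (hd : 0 < d) (hδ₀ : 0 ≤ δ) (hδ₁ : δ ≤ 1)
    {I J K : Type} [Fintype I] [Fintype J] [Fintype K] [DecidableEq I] [DecidableEq J]
    [DecidableEq K] (hI : 2 * Fintype.card I ≤ N) (hJ : 2 * Fintype.card J ≤ N)
    (hK : 2 * Fintype.card K ≤ N)
    (f : X → Y → Z → ℝ) (hf : ∀ x y z, |f x y z| ≤ 1) (hτ : 0 ≤ τ)
    (hT : ∑ x : Fin 2 → X, ∑ y : Fin 2 → Y, ∑ z : Fin 2 → Z, ind (TriConf e₁₂ e₁₃ e₂₃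
        (fun _ _ => True) (fun _ _ => True) (fun _ _ => True) x y z)
        * ∏ i, ∏ j, ∏ l, f (x i) (y j) (z l) ≤ τ * completeMain a d 2 2 2)
    (F : I × J × K → X → Y → Z → ℝ) (hF : ∀ s x y z, |F s x y z| ≤ 1)
    (α σ : I × J × K → ℝ) (hσ : ∀ s, |σ s| ≤ 1) (hα₁ : ∀ s, α s ≤ 1)
    (hFα : ∀ s x y z, F s x y z = α s + σ s * f x y z) {ε θ : ℝ} (hε : 0 ≤ ε)
    (hα : ∀ s, ε ≤ α s) (hθ : 0 ≤ θ) (hθτ : 2 ^ 7 * (τ + √(8 * δ)) ≤ θ ^ 8)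
    (hθε : Fintype.card (I × J × K) * θ < ε ^ Fintype.card (I × J × K) * (1 - δ)) :
    ∃ (x : I → X) (y : J → Y) (z : K → Z), ∀ i j k, F (i, j, k) (x i) (y j) (z k) ≠ 0 := by
  set M := completeMain a d (Fintype.card I) (Fintype.card J) (Fintype.card K) with hMdef
  have hM : 0 < M := by
    rw [hMdef, completeMain]
    positivity
  let Cf : (I → X) → (J → Y) → (K → Z) → ℝ := fun x y z =>
    ind (TriConf e₁₂ e₁₃ e₂₃ (fun _ _ => True) (fun _ _ => True) (fun _ _ => True) x y z)
  -- Telescoping: exchanging one `F s₀` for `α s₀` leaves a term `σ s₀ * f` times the remaining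
  -- factors, which costs at most θM.
  have key : ∀ S : Finset (I × J × K),
      |∑ x, ∑ y, ∑ z, Cf x y z * ∏ s ∈ S, F s (x s.1) (y s.2.1) (z s.2.2)
        - (∏ s ∈ S, α s) * ∑ x, ∑ y, ∑ z, Cf x y z| ≤ S.card * (θ * M) := by
    intro S
    induction S using Finset.induction_on with
    | empty => simp
    | insert s₀ S hs ih =>
      have h₁ := hP.sum_mul_prod_le ha hd hδ₀ hδ₁ hI hJ hK f hf hτ hT F hF S s₀ hs
      set E := ∑ x : I → X, ∑ y : J → Y, ∑ z : K → Z,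
        ind (TriConf e₁₂ e₁₃ e₂₃ (fun _ _ => True) (fun _ _ => True) (fun _ _ => True) x y z)
        * (f (x s₀.1) (y s₀.2.1) (z s₀.2.2) * ∏ s ∈ S, F s (x s.1) (y s.2.1) (z s.2.2)) with hE
      have h₂ : |E| ≤ θ * M := by
        refine le_of_pow_le_pow_left₀ (n := 8) (by norm_num) (by positivity) ?_
        rw [Even.pow_abs (by decide), mul_pow]
        exact h₁.trans (by gcongr)
      have h₃ : ∑ x, ∑ y, ∑ z, Cf x y z * ∏ s ∈ insert s₀ S, F s (x s.1) (y s.2.1) (z s.2.2)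
          = α s₀ * ∑ x, ∑ y, ∑ z, Cf x y z * ∏ s ∈ S, F s (x s.1) (y s.2.1) (z s.2.2)
            + σ s₀ * E := by
        simp only [hE, Finset.mul_sum, ← Finset.sum_add_distrib]
        refine Finset.sum_congr rfl fun x _ => Finset.sum_congr rfl fun y _ =>
          Finset.sum_congr rfl fun z _ => ?_
        rw [Finset.prod_insert hs, hFα s₀]
        simp only [Cf]
        ring
      rw [h₃, Finset.prod_insert hs, Finset.card_insert_of_notMem hs]
      set P := ∑ x, ∑ y, ∑ z, Cf x y z * ∏ s ∈ S, F s (x s.1) (y s.2.1) (z s.2.2)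
      set Q := ∑ x, ∑ y, ∑ z, Cf x y z
      have hα0 : |α s₀| ≤ 1 := abs_le.2 ⟨by linarith [hα s₀], hα₁ s₀⟩
      calc |α s₀ * P + σ s₀ * E - α s₀ * (∏ s ∈ S, α s) * Q|
          = |α s₀ * (P - (∏ s ∈ S, α s) * Q) + σ s₀ * E| := by
            congr 1
            ring
        _ ≤ |α s₀ * (P - (∏ s ∈ S, α s) * Q)| + |σ s₀ * E| := abs_add_le _ _
        _ ≤ 1 * (S.card * (θ * M)) + 1 * (θ * M) := by
            rw [abs_mul, abs_mul]
            have := hσ s₀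
            gcongr
        _ = _ := by
            push_cast
            ring
  have hall := key Finset.univ
  have hcount := hP.abs_sum_sub_le (I := I) (J := J) (K := K) (by omega) (by omega) (by omega)
    (fun _ _ => True) (fun _ _ => True) (fun _ _ => True)
  rw [triMain_true, ← hMdef] at hcount
  have hlow : (1 - δ) * M ≤ ∑ x, ∑ y, ∑ z, Cf x y z := by
    have := (abs_le.1 hcount).1
    simp only [Cf]
    linarith
  have hprodα : ε ^ Fintype.card (I × J × K) ≤ ∏ s, α s := by
    rw [← Finset.card_univ, ← Finset.prod_const]
    exact Finset.prod_le_prod (fun _ _ => hε) fun s _ => hα s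
  -- If every configuration had a vanishing factor, the main term, at least ε^T (1 - δ)M, would be
  -- bounded by the error TθM.
  by_contra! hno
  have hzero : ∑ x, ∑ y, ∑ z, Cf x y z * ∏ s, F s (x s.1) (y s.2.1) (z s.2.2) = 0 := by
    refine Finset.sum_eq_zero fun x _ => Finset.sum_eq_zero fun y _ =>
      Finset.sum_eq_zero fun z _ => ?_
    obtain ⟨i, j, k, hijk⟩ := hno x y z
    rw [Finset.prod_eq_zero (Finset.mem_univ (i, j, k)) hijk, mul_zero]
  rw [hzero, zero_sub, abs_neg, Finset.card_univ] at hall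
  have h₁ : ε ^ Fintype.card (I × J × K) * ((1 - δ) * M)
      ≤ (∏ s, α s) * ∑ x, ∑ y, ∑ z, Cf x y z := by
    refine mul_le_mul hprodα hlow ?_ ((pow_nonneg hε _).trans hprodα)
    have : 0 ≤ 1 - δ := by linarith
    positivity
  have h₂ := h₁.trans ((le_abs_self _).trans hall)
  have h₃ := mul_lt_mul_of_pos_right hθε hM
  linarith

end

/-! ### The local U³ norm as an unnormalized box sum. -/

lemma sum_piFinset_const {G M : Type*} [DecidableEq G] [AddCommMonoid M] (s : Finset G)
    (φ : (Fin 2 → G) → M) :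
    ∑ x ∈ Fintype.piFinset (fun _ : Fin 2 => s), φ x
      = ∑ x : Fin 2 → {x // x ∈ s}, φ fun i => (x i).1 := by
  symm
  refine Finset.sum_bij (fun x _ i => (x i).1) (fun x _ => ?_) (fun x _ y _ h => ?_)
    (fun y hy => ?_) fun _ _ => rfl
  · exact Fintype.mem_piFinset.2 fun i => (x i).2
  · exact funext fun i => Subtype.ext (congrFun h i)
  · exact ⟨fun i => ⟨y i, Fintype.mem_piFinset.1 hy i⟩, Finset.mem_univ _, rfl⟩

lemma prod_fin_three_arrow {M : Type*} [CommMonoid M] (φ : Fin 2 → Fin 2 → Fin 2 → M) :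
    ∏ ω : Fin 3 → Fin 2, φ (ω 0) (ω 1) (ω 2) = ∏ i, ∏ j, ∏ k, φ i j k := by
  simp only [← Fintype.prod_prod_type']
  exact Fintype.prod_equiv
    { toFun := fun ω => (ω 0, ω 1, ω 2)
      invFun := fun t => ![t.1, t.2.1, t.2.2]
      left_inv := fun ω => by
        funext i
        fin_cases i <;> rfl
      right_inv := fun _ => rfl } _ _ fun _ => rfl

lemma star_iterate_ofReal (k : ℕ) (r : ℝ) : (starRingEnd ℂ)^[k] (r : ℂ) = r := by
  induction k with
  | zero => rfl
  | succ k ih => rw [Function.iterate_succ_apply, Complex.conj_ofReal, ih]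

/-- Multiplying by the density, instead of dividing, keeps the identity valid when `β` is empty. -/
lemma prod_charMeasure_mul {V : Type*} [Fintype V] [DecidableEq V] (β : Finset (V × V))
    (x y : Fin 2 → V) :
    (∏ i, ∏ j, charMeasure β (x i) (y j)) * ((β.card : ℝ) / (Fintype.card V : ℝ) ^ 2) ^ 4
      = ind (∀ i j, (x i, y j) ∈ β) := by
  have h : ∀ u v, charMeasure β u v * ((β.card : ℝ) / (Fintype.card V : ℝ) ^ 2)
      = ind ((u, v) ∈ β) := by
    intro u v
    unfold charMeasure ind
    split_ifs with huv
    · have : Nonempty V := ⟨u⟩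
      have h₁ : (β.card : ℝ) ≠ 0 := by
        exact_mod_cast (Finset.card_pos.2 ⟨_, huv⟩).ne'
      have h₂ : (Fintype.card V : ℝ) ≠ 0 := by exact_mod_cast Fintype.card_ne_zero
      field_simp
    · exact zero_mul _
  have h₂ : (∀ i j, (x i, y j) ∈ β) ↔ (((x 0, y 0) ∈ β ∧ (x 0, y 1) ∈ β)
      ∧ ((x 1, y 0) ∈ β ∧ (x 1, y 1) ∈ β)) := by
    simp only [Fin.forall_fin_two]
  rw [ind_congr h₂]
  simp only [Fin.prod_univ_two, ← ind_mul, ← h]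
  ring

section

variable {p : ℕ} [Fact p.Prime] {n ℓ q : ℕ}

/-- The local `U³` inner product of a real function, as an unnormalized sum. -/
lemma localU3Inner_ofReal (B : QuadraticFactor p n ℓ q) (d : LabelTuple p ℓ q)
    (φ : (Fin n → ZMod p) → ℝ) :
    ∑ x : Fin 2 → {x // x ∈ B.atom d.a₁}, ∑ y : Fin 2 → {x // x ∈ B.atom d.a₂},
      ∑ z : Fin 2 → {x // x ∈ B.atom d.a₃}, ind (TriConf
        (fun x y => (x.1, y.1) ∈ B.bilinearLevel d.b₁₂)
        (fun x z => (x.1, z.1) ∈ B.bilinearLevel d.b₁₃)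
        (fun y z => (y.1, z.1) ∈ B.bilinearLevel d.b₂₃)
        (fun _ _ => True) (fun _ _ => True) (fun _ _ => True) x y z)
        * ∏ i, ∏ j, ∏ l, φ ((x i).1 + (y j).1 + (z l).1)
      = (localU3Inner B d (fun _ x => (φ x : ℂ))).re
        * (((B.atom d.a₁).card : ℝ) ^ 2 * ((B.atom d.a₂).card : ℝ) ^ 2
          * ((B.atom d.a₃).card : ℝ) ^ 2
          * (((B.bilinearLevel d.b₁₂).card : ℝ) / (Fintype.card (Fin n → ZMod p) : ℝ) ^ 2) ^ 4
          * (((B.bilinearLevel d.b₁₃).card : ℝ) / (Fintype.card (Fin n → ZMod p) : ℝ) ^ 2) ^ 4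
          * (((B.bilinearLevel d.b₂₃).card : ℝ) / (Fintype.card (Fin n → ZMod p) : ℝ) ^ 2) ^ 4) := by
  set β₁₂ := B.bilinearLevel d.b₁₂
  set β₁₃ := B.bilinearLevel d.b₁₃
  set β₂₃ := B.bilinearLevel d.b₂₃
  let ψ : (Fin 2 → Fin n → ZMod p) → (Fin 2 → Fin n → ZMod p) → (Fin 2 → Fin n → ZMod p) → ℝ :=
    fun x y z => (∏ i, ∏ j, charMeasure β₁₂ (x i) (y j)) * (∏ i, ∏ k, charMeasure β₁₃ (x i) (z k))
      * (∏ j, ∏ k, charMeasure β₂₃ (y j) (z k)) * ∏ i, ∏ j, ∏ l, φ (x i + y j + z l)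
  have h₁ : localU3Inner B d (fun _ x => (φ x : ℂ))
      = 𝔼 x ∈ Fintype.piFinset (fun _ : Fin 2 => B.atom d.a₁),
        𝔼 y ∈ Fintype.piFinset (fun _ : Fin 2 => B.atom d.a₂),
        𝔼 z ∈ Fintype.piFinset (fun _ : Fin 2 => B.atom d.a₃), (ψ x y z : ℂ) := by
    unfold localU3Inner
    refine Finset.expect_congr rfl fun x _ => Finset.expect_congr rfl fun y _ =>
      Finset.expect_congr rfl fun z _ => ?_
    simp only [star_iterate_ofReal]
    rw [prod_fin_three_arrow fun i j k => (φ (x i + y j + z k) : ℂ)]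
    simp only [ψ]
    push_cast
    rfl
  have hc : ∀ s : Finset (Fin n → ZMod p),
      ((Fintype.piFinset fun _ : Fin 2 => s).card : ℂ) = (s.card : ℂ) ^ 2 := fun s => by
    rw [Fintype.card_piFinset_const]
    push_cast
    rfl
  have h₂ : ((∑ x ∈ Fintype.piFinset (fun _ : Fin 2 => B.atom d.a₁),
        ∑ y ∈ Fintype.piFinset (fun _ : Fin 2 => B.atom d.a₂),
        ∑ z ∈ Fintype.piFinset (fun _ : Fin 2 => B.atom d.a₃), ψ x y z : ℝ) : ℂ)
      = (((B.atom d.a₁).card : ℝ) ^ 2 * ((B.atom d.a₂).card : ℝ) ^ 2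
          * ((B.atom d.a₃).card : ℝ) ^ 2 : ℝ) * localU3Inner B d (fun _ x => (φ x : ℂ)) := by
    rw [h₁]
    push_cast
    rw [← Finset.card_mul_expect, hc]
    simp only [← Finset.card_mul_expect (Fintype.piFinset fun _ : Fin 2 => B.atom d.a₂),
      ← Finset.card_mul_expect (Fintype.piFinset fun _ : Fin 2 => B.atom d.a₃), hc,
      ← Finset.mul_expect]
    ring
  have h₃ := congrArg Complex.re h₂
  rw [Complex.re_ofReal_mul, Complex.ofReal_re] at h₃
  simp only [sum_piFinset_const] at h₃
  have h₄ : ∀ A D E : ℝ, (localU3Inner B d (fun _ x => (φ x : ℂ))).re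
        * (((B.atom d.a₁).card : ℝ) ^ 2 * ((B.atom d.a₂).card : ℝ) ^ 2
          * ((B.atom d.a₃).card : ℝ) ^ 2 * A * D * E)
      = (((B.atom d.a₁).card : ℝ) ^ 2 * ((B.atom d.a₂).card : ℝ) ^ 2
          * ((B.atom d.a₃).card : ℝ) ^ 2) * (localU3Inner B d (fun _ x => (φ x : ℂ))).re
          * (A * D * E) := fun A D E => by ring
  rw [h₄, ← h₃]
  simp only [Finset.sum_mul]
  refine Finset.sum_congr rfl fun x _ => Finset.sum_congr rfl fun y _ =>
    Finset.sum_congr rfl fun z _ => ?_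
  simp only [TriConf, true_imp_iff, ← ind_mul, ψ,
    ← prod_charMeasure_mul β₁₂ (fun i => (x i).1) (fun i => (y i).1),
    ← prod_charMeasure_mul β₁₃ (fun i => (x i).1) (fun i => (z i).1),
    ← prod_charMeasure_mul β₂₃ (fun i => (y i).1) (fun i => (z i).1)]
  ring

lemma card_bilinearLevel_le (B : QuadraticFactor p n ℓ q) (hp : 2 < p) (b : Fin q → ZMod p)
    {R : ℕ} (hR : ∀ c : Fin q → ZMod p, c ≠ 0 → 2 * R ≤ (∑ j, c j • B.M j).rank) (hq : q ≤ R) :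
    ((B.bilinearLevel b).card : ℝ) / (Fintype.card (Fin n → ZMod p) : ℝ) ^ 2
      ≤ 2 * (1 / (p : ℝ) ^ q) := by
  have hp0 : (0 : ℝ) < p := by exact_mod_cast (by omega : 0 < p)
  -- A single edge on two vertices without linear forms. Here s = 0, so the relative error is 1 and
  -- the bound is twice the expected density.
  have h := card_systemForm_eq_approx B hp (fun _ : Unit => (0 : Fin 2)) (fun _ => 1)
    (fun _ _ _ => rfl) (fun e : Empty => e.elim) (fun e => e.elim) hR (s := 0) (D := q) (by simp)
    (by simpa using hq) (Sum.elim (fun e => b e.2) (fun e => e.1.elim))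
  have hcard : Nat.card {x : Fin 2 → Fin n → ZMod p // systemForm B (fun _ : Unit => (0 : Fin 2))
      (fun _ => 1) (fun e : Empty => e.elim) x = Sum.elim (fun e => b e.2) (fun e => e.1.elim)}
      = (B.bilinearLevel b).card := by
    have hb : (B.bilinearLevel b).card = Nat.card {w // w ∈ B.bilinearLevel b} := by
      rw [Nat.card_eq_fintype_card, Fintype.card_coe]
    rw [hb]
    refine Nat.card_congr ((finTwoArrowEquiv _).subtypeEquiv fun x => ?_)
    simp [funext_iff, systemForm, QuadraticFactor.bilinearLevel]
  rw [hcard] at h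
  have h2 := (abs_le.1 h).2
  simp only [Fintype.card_fin, pow_zero, one_mul] at h2
  have hV : (Fintype.card (Fin n → ZMod p) : ℝ) = (p : ℝ) ^ n := by simp
  rw [hV, div_le_iff₀ (by positivity)]
  calc ((B.bilinearLevel b).card : ℝ) ≤ 2 * (((p : ℝ) ^ n) ^ 2 / (p : ℝ) ^ q) := by linarith
    _ = _ := by ring

lemma TriPseudorandom.card_le {X Y Z : Type*} [Fintype X] [Fintype Y] [Fintype Z]
    {e₁₂ : X → Y → Prop} {e₁₃ : X → Z → Prop} {e₂₃ : Y → Z → Prop} {a d δ : ℝ} {N : ℕ}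
    (hP : TriPseudorandom e₁₂ e₁₃ e₂₃ a d δ N) (ha : 0 < a) (hδ₁ : δ ≤ 1) (hN : 1 ≤ N) :
    (Fintype.card X : ℝ) ≤ 2 * a ∧ (Fintype.card Y : ℝ) ≤ 2 * a ∧
      (Fintype.card Z : ℝ) ≤ 2 * a := by
  have h₁ := hP.abs_sum_sub_le (I := Unit) (J := Empty) (K := Empty) (by simpa) (by simp)
    (by simp) (fun _ _ => True) (fun _ _ => True) (fun _ _ => True)
  have h₂ := hP.abs_sum_sub_le (I := Empty) (J := Unit) (K := Empty) (by simp) (by simpa)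
    (by simp) (fun _ _ => True) (fun _ _ => True) (fun _ _ => True)
  have h₃ := hP.abs_sum_sub_le (I := Empty) (J := Empty) (K := Unit) (by simp) (by simp)
    (by simpa) (fun _ _ => True) (fun _ _ => True) (fun _ _ => True)
  rw [triMain_true] at h₁ h₂ h₃
  simp [completeMain, TriConf, ind] at h₁ h₂ h₃
  refine ⟨?_, ?_, ?_⟩
  · nlinarith [(abs_le.1 h₁).2]
  · nlinarith [(abs_le.1 h₂).2]
  · nlinarith [(abs_le.1 h₃).2]

end

/-! ### From a small local U³ norm to `HasIP2`. -/

section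

variable {p : ℕ} [Fact p.Prime] {n ℓ q : ℕ}

/-- A small local `U³` norm bounds the corresponding unnormalized box sum. -/
lemma box_sum_le_of_localU3Norm_lt (B : QuadraticFactor p n ℓ q) (hp : 2 < p)
    (d : LabelTuple p ℓ q) {N s : ℕ} (hN : 1 ≤ N)
    (hR : ∀ c : Fin q → ZMod p, c ≠ 0 →
      2 * ((ℓ + q) * (3 * N + 3 * N ^ 2) + s) ≤ (∑ j, c j • B.M j).rank)
    (φ : (Fin n → ZMod p) → ℝ) {η : ℝ} (hη : 0 < η)
    (h : localU3Norm B d (fun x => (φ x : ℂ)) < η) :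
    ∑ x : Fin 2 → {x // x ∈ B.atom d.a₁}, ∑ y : Fin 2 → {x // x ∈ B.atom d.a₂},
      ∑ z : Fin 2 → {x // x ∈ B.atom d.a₃}, ind (TriConf
        (fun x y => (x.1, y.1) ∈ B.bilinearLevel d.b₁₂)
        (fun x z => (x.1, z.1) ∈ B.bilinearLevel d.b₁₃)
        (fun y z => (y.1, z.1) ∈ B.bilinearLevel d.b₂₃)
        (fun _ _ => True) (fun _ _ => True) (fun _ _ => True) x y z)
        * ∏ i, ∏ j, ∏ l, φ ((x i).1 + (y j).1 + (z l).1)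
      ≤ 2 ^ 18 * η ^ 8 *
        completeMain ((p : ℝ) ^ n / (p : ℝ) ^ (ℓ + q)) (1 / (p : ℝ) ^ q) 2 2 2 := by
  have hp0 : (0 : ℝ) < p := by exact_mod_cast (by omega : 0 < p)
  rw [localU3Inner_ofReal]
  unfold localU3Norm at h
  set r := (localU3Inner B d (fun _ x => (φ x : ℂ))).re
  have hr : r ≤ η ^ 8 := by
    -- For r ≤ 0 the bound is trivial, so non-negativity of the inner product need not be
    -- established.
    by_cases hr0 : r ≤ 0
    · exact hr0.trans (by positivity)
    · push Not at hr0
      have h8 := pow_le_pow_left₀ (Real.rpow_nonneg hr0.le _) h.le 8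
      rw [← Real.rpow_natCast, ← Real.rpow_mul hr0.le] at h8
      norm_num at h8
      exact h8
  have hP := B.triPseudorandom hp d hR
  have hδ : ((1 : ℝ) / 2) ^ s ≤ 1 := pow_le_one₀ (by norm_num) (by norm_num)
  set a := (p : ℝ) ^ n / (p : ℝ) ^ (ℓ + q)
  have ha : 0 < a := by positivity
  set δ := 1 / (p : ℝ) ^ q with hδdef
  have hδ0 : 0 < δ := by positivity
  obtain ⟨hX, hY, hZ⟩ := hP.card_le ha hδ hN
  rw [Fintype.card_coe] at hX hY hZ
  have hq : q ≤ (ℓ + q) * (3 * N + 3 * N ^ 2) + s := by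
    have : 1 ≤ 3 * N + 3 * N ^ 2 := by nlinarith
    nlinarith
  have hb := fun b => card_bilinearLevel_le B hp b hR hq
  rw [← hδdef] at hb
  have h₁ := hb d.b₁₂
  have h₂ := hb d.b₁₃
  have h₃ := hb d.b₂₃
  refine (mul_le_mul_of_nonneg_right hr (by positivity)).trans ?_
  -- The constant is 2^6 from the sizes of the atoms times 2^12 from the densities of the level
  -- sets.
  calc _ ≤ η ^ 8 * ((2 * a) ^ 2 * (2 * a) ^ 2 * (2 * a) ^ 2 * (2 * δ) ^ 4 * (2 * δ) ^ 4
          * (2 * δ) ^ 4) := by gcongr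
    _ = _ := by
        unfold completeMain
        ring

/-- If `A` has local `U³` norm small compared with its distance from a constant `α` that is
neither close to `0` nor to `1`, then `A` has `m`-`IP₂`. -/
lemma hasIP2_of_localU3Norm_lt (B : QuadraticFactor p n ℓ q) (hp : 2 < p)
    (d : LabelTuple p ℓ q) {m N s : ℕ} (hm : 1 ≤ m) (hN : 2 * (m + 2 ^ (m * m)) ≤ N)
    (hR : ∀ c : Fin q → ZMod p, c ≠ 0 →
      2 * ((ℓ + q) * (3 * N + 3 * N ^ 2) + s) ≤ (∑ j, c j • B.M j).rank)
    (A : Finset (Fin n → ZMod p)) {α ε θ : ℝ} (hε : 0 < ε) (hα₀ : ε ≤ α) (hα₁ : α ≤ 1 - ε)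
    (hθ : θ = ε ^ (m * (m * 2 ^ (m * m))) / (4 * (m * (m * 2 ^ (m * m)) : ℕ)))
    (hs : ((1 : ℝ) / 2) ^ s ≤ 1 / 2) (hsθ : √(8 * (1 / 2) ^ s) ≤ θ ^ 8 / 2 ^ 8)
    (h : localU3Norm B d (fun x => (((if x ∈ A then 1 else 0) - α : ℝ) : ℂ)) < θ / 2 ^ 4) :
    HasIP2 m (A : Set (Fin n → ZMod p)) := by
  classical
  have hp0 : (0 : ℝ) < p := by exact_mod_cast (by omega : 0 < p)
  set T := m * (m * 2 ^ (m * m)) with hTdef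
  have hT : 0 < T := by positivity
  have hT' : (0 : ℝ) < T := by exact_mod_cast hT
  have hθ0 : 0 < θ := by
    rw [hθ]
    positivity
  have hcardK : Fintype.card (Finset (Fin m × Fin m)) = 2 ^ (m * m) := by simp
  have hcardT : Fintype.card (Fin m × Fin m × Finset (Fin m × Fin m)) = T := by
    simp [hTdef]
  have hN1 : 1 ≤ N := by omega
  have hbox := box_sum_le_of_localU3Norm_lt B hp d hN1 hR
    (fun x => (if x ∈ A then 1 else 0) - α) (by positivity) h
  have hP := B.triPseudorandom hp d hR
  have hmem : ∀ x : Fin n → ZMod p, (0 : ℝ) ≤ (if x ∈ A then 1 else 0) ∧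
      (if x ∈ A then (1 : ℝ) else 0) ≤ 1 := fun x => by split_ifs <;> norm_num
  obtain ⟨x, y, z, hxyz⟩ := hP.exists_pattern (by positivity) (by positivity) (by positivity)
    (hs.trans (by norm_num)) (I := Fin m) (J := Fin m) (K := Finset (Fin m × Fin m))
    (by simp; omega) (by simp; omega) (by rw [hcardK]; omega)
    (fun x y z => (if x.1 + y.1 + z.1 ∈ A then 1 else 0) - α)
    (fun x y z => abs_le.2 ⟨by linarith [(hmem (x.1 + y.1 + z.1)).1],
      by linarith [(hmem (x.1 + y.1 + z.1)).2]⟩)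
    (by positivity) hbox
    -- The factor at (i, j, S) is non-zero exactly when membership of x_i + y_j + z_S in A agrees
    -- with (i, j) ∈ S. All sets S are handled at once.
    (fun t x y z => if (t.1, t.2.1) ∈ t.2.2 then (if x.1 + y.1 + z.1 ∈ A then 1 else 0)
      else 1 - (if x.1 + y.1 + z.1 ∈ A then 1 else 0))
    (fun t x y z => by split_ifs <;> simp)
    (fun t => if (t.1, t.2.1) ∈ t.2.2 then α else 1 - α)
    (fun t => if (t.1, t.2.1) ∈ t.2.2 then 1 else -1)
    (fun t => by split_ifs <;> simp)
    (fun t => by split_ifs <;> linarith)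
    (fun t x y z => by split_ifs <;> ring)
    (ε := ε) (θ := θ) hε.le (fun t => by split_ifs <;> linarith) hθ0.le
    (by
      -- The box norm contributes θ^8 / 2^7 and pseudorandomness at most θ^8 / 2, within the allowed
      -- θ^8.
      have : 2 ^ 18 * (θ / 2 ^ 4) ^ 8 = θ ^ 8 / 2 ^ 14 := by ring
      rw [this]
      have : 0 < θ ^ 8 := by positivity
      linarith)
    (by
      rw [hcardT]
      -- The choice of θ makes the total error ε^T / 4, below the main term ε^T (1 - δ) because δ ≤
      -- 1/2.
      have h1 : (T : ℝ) * θ = ε ^ T / 4 := by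
        rw [hθ]
        field_simp
      rw [h1]
      have : 0 < ε ^ T := by positivity
      nlinarith)
  refine ⟨fun i => (x i).1, fun j => (y j).1, fun S => (z S).1, fun i j S => ?_⟩
  have := hxyz i j S
  rw [Finset.mem_coe]
  by_cases h1 : (i, j) ∈ S <;> by_cases h2 : (x i).1 + (y j).1 + (z S).1 ∈ A <;> simp [h1, h2] at this ⊢

end

end QuadFactor

/-! ### Choice of constants and conclusion. -/

theorem mainTheorem3 :
    ∀ ε : ℝ, 0 < ε → ∀ m : ℕ, 1 ≤ m →
      ∃ η : ℝ, 0 < η ∧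
      ∃ ρ₀ : ℝ≥0 → ℝ≥0, QuadFactor.IsGrowthFunction ρ₀ ∧ QuadFactor.IsPolynomialFunction ρ₀ ∧
        ∀ (p : ℕ) [Fact p.Prime], 2 < p →
        ∀ ρ : ℝ≥0 → ℝ≥0, QuadFactor.IsGrowthFunction ρ → (∀ x, ρ₀ x ≤ ρ x) →
        ∀ ℓ q n : ℕ, ℓ + q < n →
        ∀ A : Finset (Fin n → ZMod p),
          QuadFactor.vc2Dim (A : Set (Fin n → ZMod p)) < (m : ℕ∞) →
        ∀ B : QuadFactor.QuadraticFactor p n ℓ q,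
          (ρ ((ℓ + q : ℕ) : ℝ≥0) : ℝ≥0∞) ≤ (B.rank : ℝ≥0∞) →
        ∀ d : QuadFactor.LabelTuple p ℓ q,
          QuadFactor.localU3Norm B d
            (fun x => (if x ∈ A then 1 else 0) - (B.density A d.sigma : ℂ)) < η →
          B.density A d.sigma ∈ Set.Ico (0 : ℝ) ε ∪ Set.Ioc (1 - ε) 1 := by
  intro ε hε m hm
  let T := m * (m * 2 ^ (m * m))
  have hT : 0 < T := by positivity
  let θ : ℝ := ε ^ T / (4 * (T : ℕ))
  have hθ : 0 < θ := by
    have : (0 : ℝ) < T := by exact_mod_cast hT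
    positivity
  -- The relative error 2^(-s) must be at most 1/2 and must satisfy √(8 · 2^(-s)) ≤ θ^8 / 2^8.
  obtain ⟨s, hs⟩ := exists_pow_lt_of_lt_one
    (show (0 : ℝ) < min (1 / 2) ((θ ^ 8 / 2 ^ 8) ^ 2 / 8) by positivity)
    (show (1 / 2 : ℝ) < 1 by norm_num)
  have hs₁ : (1 / 2 : ℝ) ^ s ≤ 1 / 2 := hs.le.trans (min_le_left _ _)
  have hs₂ : √(8 * (1 / 2 : ℝ) ^ s) ≤ θ ^ 8 / 2 ^ 8 := by
    rw [Real.sqrt_le_left (by positivity)]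
    linarith [hs.le.trans (min_le_right _ _)]
  let N := 2 * (m + 2 ^ (m * m))
  let C := 3 * N + 3 * N ^ 2
  have hC : 0 < C := by positivity
  -- A linear `ρ₀` suffices: at most C(ℓ + q) equations are imposed, s further powers of p are
  -- saved, and the factor 2 pays for the square root in Weyl differencing.
  refine ⟨θ / 2 ^ 4, by positivity, fun x => ((2 * C : ℕ) : ℝ≥0) * x + ((2 * s : ℕ) : ℝ≥0), ?_,
    ⟨Polynomial.C ((2 * C : ℕ) : ℝ) * Polynomial.X + Polynomial.C ((2 * s : ℕ) : ℝ), fun x => by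
      simp⟩, ?_⟩
  · intro x y hxy
    have : (0 : ℝ≥0) < ((2 * C : ℕ) : ℝ≥0) := by
      exact_mod_cast (by omega : 0 < 2 * C)
    exact add_lt_add_left (mul_lt_mul_of_pos_left hxy this) _
  intro p _ hp ρ _ hρ ℓ q n _ A hA B hrank d hU
  have hρ₀ := hρ ((ℓ + q : ℕ) : ℝ≥0)
  have hR : ∀ c : Fin q → ZMod p, c ≠ 0 →
      2 * ((ℓ + q) * (3 * N + 3 * N ^ 2) + s) ≤ (∑ j, c j • B.M j).rank := by
    intro c hc
    have h₁ : ((2 * ((ℓ + q) * C + s) : ℕ) : ℝ≥0∞) ≤ (B.rank : ℝ≥0∞) := by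
      refine le_trans ?_ hrank
      have : ((2 * ((ℓ + q) * C + s) : ℕ) : ℝ≥0) ≤ ρ ((ℓ + q : ℕ) : ℝ≥0) := by
        refine le_trans (le_of_eq ?_) hρ₀
        push_cast
        ring
      exact_mod_cast this
    have h₂ : ((2 * ((ℓ + q) * C + s) : ℕ) : ℕ∞) ≤ B.rank := by
      rw [← ENat.toENNReal_le]
      simpa using h₁
    have h₃ : B.rank ≤ ((∑ j, c j • B.M j).rank : ℕ∞) := iInf₂_le c hc
    exact_mod_cast h₂.trans h₃
  have h0 : 0 ≤ B.density A d.sigma := by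
    unfold QuadFactor.QuadraticFactor.density
    positivity
  have h1 : B.density A d.sigma ≤ 1 := by
    unfold QuadFactor.QuadraticFactor.density
    refine div_le_one_of_le₀ ?_ (by positivity)
    exact_mod_cast Finset.card_le_card Finset.inter_subset_right
  by_contra hcon
  simp only [Set.mem_union, Set.mem_Ico, Set.mem_Ioc, not_or, not_and, not_lt, not_le] at hcon
  have hα₀ := hcon.1 h0
  have hα₁ : B.density A d.sigma ≤ 1 - ε := by
    by_contra hlt
    exact absurd (hcon.2 (not_le.1 hlt)) (not_lt.2 h1)
  have hIP := QuadFactor.hasIP2_of_localU3Norm_lt B hp d hm (le_refl N) hR A hε hα₀ hα₁ rfl hs₁ hs₂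
    (by
      convert! hU using 3
      split_ifs <;> simp)
  exact absurd (le_iSup₂ (f := fun (m : ℕ) (_ : QuadFactor.HasIP2 m
    (A : Set (Fin n → ZMod p))) => (m : ℕ∞)) m hIP) (not_le.2 hA)
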